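/- **Setting.** Terms, atoms and clauses are first-order, over function symbols and predicate symbols with arities; constants are nullary function symbols, and the predicate symbols include the binary symbol $\approx$. A clause $\mathcal H\gets\mathcal B$ has a finite disjunction $\mathcal H$ of head atoms and a finite conjunction $\mathcal B$ of body atoms (either may be empty); a clause set is a finite set of clauses. A clause is *range-restricted* if every variable of it occurs in its body, and a clause set is range-restricted if all its clauses are. A clause set is *E-satisfiable* if all its clauses (universally quantified) hold in some first-order interpretation with nonempty domain in which $\approx$ is the identity. A *proper functional term* is a term that is neither a variable nor a constant. For a clause set $M$, $\Sigma_f(M)$ is the set of function symbols occurring in $M$, and $\Sigma_P(M)$ is the set of predicate symbols occurring in $M$, together with $\approx$. Let $\mathrm{dom}$ (unary), $\mathrm{sub}$ (binary) and, for each predicate symbol $P$, a symbol $\overline P$ of the same arity be fresh predicate symbols (not occurring in the given clause sets); $\overline{\approx}$ is written $\not\approx$, and $\overline A$ is the atom $A$ with its predicate symbol $P$ replaced by $\overline P$. Let $c$ be any constant (it may or may not occur in the given clause set). The *restriction* of $\mathcal H\gets\mathcal B$ is $\mathcal H\gets\mathcal B\wedge\mathrm{dom}(x_1)\wedge\dots\wedge\mathrm{dom}(x_k)$,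 where $x_1,\dots,x_k$ are the distinct variables that occur in $\mathcal H$ but not in $\mathcal B$. * $\mathrm{crr}(M)$ consists of the restrictions of the clauses in $M\cup\{\mathrm{dom}(c)\gets\top\}$ and the clauses $\mathrm{dom}(f(x_1,\dots,x_n))\gets\mathrm{dom}(x_1)\wedge\dots\wedge\mathrm{dom}(x_n)$ for all $n$-ary $f\in\Sigma_f(M)$. * $\mathrm{rr}(M)$ consists of the restrictions of (a) the clauses of $M$, (b) $\mathrm{dom}(c)\gets\top$, and (c) the clauses $\mathrm{dom}(t_i)\gets P(s_1,\dots,s_n)$ for all atoms $P(t_1,\dots,t_n)$ in bodies of clauses of $M$ and all $i$ such that $t_i$ is not a variable, where $s_j=t_j$ if $t_j$ is a variable and the other $s_j$ are distinct fresh variables; and further of the clauses $\mathrm{dom}(x_i)\gets P(x_1,\dots,x_n)$ for all $n$-ary $P\in\Sigma_P(M)$, $1\le i\le n$, and $\mathrm{dom}(x_i)\gets\mathrm{dom}(f(x_1,\dots,x_n))$ for all $n$-ary $f\in\Sigma_f(M)$, $1\le i\le n$. * $\mathrm{sh}(M)=\mathrm{bs}(\mathrm{pf}(M))$. Here $\mathrm{pf}(M)$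 is obtained from $M\cup\{x\approx x\gets\top\}$ by replacing, in every clause, each occurrence of a proper functional term $t_j$ as an argument of a body atom whose predicate symbol is not $\approx$ by its own fresh variable $x_j$, and adding all the equations $t_j\approx x_j$ to the body. And $\mathrm{bs}(M)$ is obtained from $M$ by replacing every clause $\mathcal H\gets B_1\wedge\dots\wedge B_m\wedge\mathcal B$, where $B_1,\dots,B_m$ are the body atoms that contain a proper functional term, by $\mathcal H\vee\overline{B_1}\vee\dots\vee\overline{B_m}\gets\mathcal B$, and adding $\bot\gets P(x_1,\dots,x_n)\wedge\overline P(x_1,\dots,x_n)$ for the predicate symbol $P$ of each such atom $B_i$. * The blocking transformations all add the clause $\bot\gets x\approx y\wedge x\not\approx y$ to $M$. Moreover, *subterm domain blocking* adds the subterm axioms $\mathrm{sub}(x,x)\gets\mathrm{dom}(x)$ and $\mathrm{sub}(x,f(x_1,\dots,x_n))\gets\mathrm{sub}(x,x_i)\wedge\mathrm{dom}(x)\wedge\mathrm{dom}(f(x_1,\dots,x_n))$ for all $n$-ary $f\in\Sigma_f(M)$ and $1\le i\le n$, and the clause $x\approx y\vee x\not\approx y\gets\mathrm{sub}(x,y)$;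 *subterm predicate blocking* adds the same subterm axioms and the clauses $x\approx y\vee x\not\approx y\gets\mathrm{sub}(x,y)\wedge p(x)\wedge p(y)$ for all unary $p\in\Sigma_P(M)\setminus\{\mathrm{dom}\}$; *unrestricted domain blocking* adds the clause $x\approx y\vee x\not\approx y\gets\mathrm{dom}(x)\wedge\mathrm{dom}(y)$; *unrestricted predicate blocking* adds the clauses $x\approx y\vee x\not\approx y\gets p(x)\wedge p(y)$ for all unary $p\in\Sigma_P(M)\setminus\{\mathrm{dom}\}$. **Theorem (Completeness of the combined transformations with respect to E-interpretations).** Let $\mathrm{tr}$ be any of the twenty transformations that consist of, in this order: optionally $\mathrm{sh}$; then $\mathrm{rr}$ or $\mathrm{crr}$; then optionally one of the four blocking transformations. Then for every clause set $M$ (in which $\mathrm{dom}$, $\mathrm{sub}$ and the symbols $\overline P$ do not occur): 1. $\mathrm{tr}(M)$ is range-restricted. 2. $\mathrm{tr}(M)$ can be computed in quadratic time: there is a program that, given $c$ and a list of the clauses of $M$, outputs a list of the clauses of $\mathrm{tr}(M)$ in $O(n^2)$ steps, where $n$ is the number of occurrences of symbols in the given list (variables, function symbols, predicate symbols, and one $\gets$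 per clause). Programs are systems of first-order recursive functions on binary trees with natural numbers at the leaves (names of variables and symbols are single numbers), in which building a pair, taking a pair apart, testing for a pair, and successor, equality test and comparison of numbers take one step each. 3. If $\mathrm{tr}(M)\cup\{x\approx x\gets\mathrm{dom}(x)\}$ is E-satisfiable, then $M$ is E-satisfiable. -/

import Mathlib

namespace BUMG

/-! ## Symbols, terms, atoms and clauses -/

/-- A function symbol `name/arity`.  Constants are the symbols of arity `0`. -/
structure FunSym where
  name : ℕ
  arity : ℕ

/-- Predicate symbols: the equality symbol, the ordinary symbols `name/arity`, and the symbols that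
are fresh with respect to the input signature: the unary symbol `dom`, the binary symbol `sub`, and,
for every predicate symbol `p`, its uniquely associated negated copy `neg p`. -/
inductive PredSym where
  | eq : PredSym
  | user (name arity : ℕ) : PredSym
  | dom : PredSym
  | sub : PredSym
  | neg (p : PredSym) : PredSym

def PredSym.arity : PredSym → ℕ
  | .eq => 2
  | .user _ n => n
  | .dom => 1
  | .sub => 2
  | .neg p => p.arity

def PredSym.isEq : PredSym → Bool
  | .eq => true
  | _ => false

/-- The symbols allowed in the given signature. -/
def PredSym.isOrdinary : PredSym → Bool
  | .eq => true
  | .user _ _ => true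
  | _ => false

/-- First-order terms over the variables `0, 1, 2, …`. -/
inductive Term where
  | var (x : ℕ) : Term
  | app (f : FunSym) (args : Fin f.arity → Term) : Term

structure Atom where
  pred : PredSym
  args : Fin pred.arity → Term

/-- The clause `H₁ ∨ ⋯ ∨ Hₘ ← B₁ ∧ ⋯ ∧ Bₖ`, given by its head atoms and its body atoms. -/
structure Clause where
  head : List Atom
  body : List Atom

def Term.isVar : Term → Bool
  | .var _ => true
  | .app _ _ => false

/-- A proper functional term is neither a variable nor a constant. -/
def Term.isProper : Term → Bool
  | .var _ => false
  | .app f _ => decide (0 < f.arity)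

/-- The list of the occurrences of variables in a term. -/
def Term.vars : Term → List ℕ
  | .var x => [x]
  | .app _ args => (List.ofFn fun i => (args i).vars).flatten

/-- The list of the occurrences of function symbols in a term. -/
def Term.funs : Term → List FunSym
  | .var _ => []
  | .app f args => f :: (List.ofFn fun i => (args i).funs).flatten

def Atom.vars (A : Atom) : List ℕ := (List.ofFn fun i => (A.args i).vars).flatten

def Atom.funs (A : Atom) : List FunSym := (List.ofFn fun i => (A.args i).funs).flatten

def atomsVars (l : List Atom) : List ℕ := l.flatMap Atom.vars

def Clause.atoms (C : Clause) : List Atom := C.head ++ C.body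

def Clause.vars (C : Clause) : List ℕ := atomsVars C.atoms

/-- The function symbols that occur in a clause set. -/
def funSyms (M : Set Clause) : Set FunSym := {f | ∃ C ∈ M, ∃ A ∈ C.atoms, f ∈ A.funs}

/-- The predicate symbols of a clause set: those that occur in it, and always equality. -/
def predSyms (M : Set Clause) : Set PredSym :=
  {p | p = PredSym.eq ∨ ∃ C ∈ M, ∃ A ∈ C.atoms, A.pred = p}

/-- Clause sets over the given signature, in which the symbols `dom`, `sub` and `neg p` are fresh.-/
def IsInput (M : Set Clause) : Prop := ∀ p ∈ predSyms M, p.isOrdinary = true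

/-- Every variable of the clause occurs in its body. -/
def Clause.RangeRestricted (C : Clause) : Prop := ∀ x ∈ C.vars, x ∈ atomsVars C.body

def RangeRestricted (M : Set Clause) : Prop := ∀ C ∈ M, C.RangeRestricted

/-- The least number above all members of a list: the variables from there on are fresh. -/
def freshVar (l : List ℕ) : ℕ := l.foldr (fun x m => max (x + 1) m) 0

def eqAtom (s t : Term) : Atom := ⟨.eq, (![s, t] : Fin 2 → Term)⟩

def domAtom (t : Term) : Atom := ⟨.dom, (![t] : Fin 1 → Term)⟩

def subAtom (s t : Term) : Atom := ⟨.sub, (![s, t] : Fin 2 → Term)⟩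

/-- The atom `p(x₁, …, xₙ)` with pairwise distinct variables. -/
def genAtom (p : PredSym) : Atom := ⟨p, fun i => .var i⟩

/-- The term `f(x₁, …, xₙ)`, the variables being numbered from `k`. -/
def genTerm (f : FunSym) (k : ℕ) : Term := .app f fun i => .var (k + i)

def Atom.neg (A : Atom) : Atom := ⟨.neg A.pred, A.args⟩

/-- The constant symbol with a given name, as a term. -/
def constTerm (c : ℕ) : Term := .app ⟨c, 0⟩ Fin.elim0

/-! ## Range-restricting transformations -/

/-- The pairwise distinct variables that occur in the head but not in the body. -/
def Clause.headOnlyVars (C : Clause) : List ℕ :=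
  ((atomsVars C.head).filter fun x => decide (x ∉ atomsVars C.body)).dedup

/-- `H ← B` becomes `H ← B ∧ dom(x₁) ∧ ⋯ ∧ dom(xₖ)`. -/
def Clause.restrict (C : Clause) : Clause :=
  ⟨C.head, C.body ++ C.headOnlyVars.map fun x => domAtom (.var x)⟩

/-- The clause `dom(c) ← ⊤`. -/
def domConst (c : ℕ) : Clause := ⟨[domAtom (constTerm c)], []⟩

/-- The classical range-restricting transformation; `c` names the added constant. -/
def crr (c : ℕ) (M : Set Clause) : Set Clause :=
  Clause.restrict '' (M ∪ {domConst c}) ∪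
    {C | ∃ f ∈ funSyms M,
      C = ⟨[domAtom (genTerm f 0)], List.ofFn fun i : Fin f.arity => domAtom (.var i)⟩}

/-- The term abstraction of an atom: its arguments that are not variables are replaced by distinct
fresh variables. -/
def Atom.abstraction (A : Atom) : Atom :=
  ⟨A.pred, fun i => if (A.args i).isVar then A.args i else .var (freshVar A.vars + i)⟩

/-- The clauses `dom(tᵢ) ← P(s₁, …, sₙ)` for the body atoms `P(t₁, …, tₙ)` of clauses in `M`, where
`P(s₁, …, sₙ)` is the term abstraction and `tᵢ` is not a variable. -/
def bodyDom (M : Set Clause) : Set Clause :=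
  {D | ∃ C ∈ M, ∃ A ∈ C.body, ∃ i, (A.args i).isVar = false ∧
    D = ⟨[domAtom (A.args i)], [A.abstraction]⟩}

/-- The clauses `dom(xᵢ) ← P(x₁, …, xₙ)`. -/
def predDom (M : Set Clause) : Set Clause :=
  {D | ∃ p ∈ predSyms M, ∃ i : Fin p.arity, D = ⟨[domAtom (.var i)], [genAtom p]⟩}

/-- The clauses `dom(xᵢ) ← dom(f(x₁, …, xₙ))`. -/
def funDom (M : Set Clause) : Set Clause :=
  {D | ∃ f ∈ funSyms M, ∃ i : Fin f.arity, D = ⟨[domAtom (.var i)], [domAtom (genTerm f 0)]⟩}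

/-- The new range-restricting transformation; `c` names the added constant. -/
def rr (c : ℕ) (M : Set Clause) : Set Clause :=
  Clause.restrict '' (M ∪ {domConst c} ∪ bodyDom M) ∪ predDom M ∪ funDom M

/-! ## Shifting -/

/-- The atom contains a proper functional term. -/
def Atom.isDeep (A : Atom) : Bool := (List.ofFn fun i => (A.args i).isProper).any id

/-- Replace the proper functional top-level terms of a non-equational atom by the fresh variables
`k, k + 1, …`, each argument position having its own variable. -/
def Atom.flat (k : ℕ) (A : Atom) : Atom :=
  if A.pred.isEq then A
  else ⟨A.pred, fun i => if (A.args i).isProper then .var (k + i) else A.args i⟩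

/-- The equations `tᵢ ≈ xᵢ` for the terms replaced by `Atom.flat`. -/
def Atom.flatEqs (k : ℕ) (A : Atom) : List Atom :=
  if A.pred.isEq then []
  else (List.ofFn fun i =>
    if (A.args i).isProper then [eqAtom (A.args i) (.var (k + i))] else []).flatten

def flatAtoms : ℕ → List Atom → List Atom
  | _, [] => []
  | k, A :: l => A.flat k :: flatAtoms (k + A.pred.arity) l

def flatAtomsEqs : ℕ → List Atom → List Atom
  | _, [] => []
  | k, A :: l => A.flatEqs k ++ flatAtomsEqs (k + A.pred.arity) l

/-- `H ← B[t₁, …, tₙ]` becomes `H ← B[x₁, …, xₙ] ∧ t₁ ≈ x₁ ∧ ⋯ ∧ tₙ ≈ xₙ`. -/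
def Clause.flatten (C : Clause) : Clause :=
  ⟨C.head, flatAtoms (freshVar C.vars) C.body ++ flatAtomsEqs (freshVar C.vars) C.body⟩

/-- Partial flattening: add `x ≈ x ← ⊤` and flatten all clauses. -/
def pf (M : Set Clause) : Set Clause :=
  Clause.flatten '' (M ∪ {⟨[eqAtom (.var 0) (.var 0)], []⟩})

/-- `H ← B₁ ∧ ⋯ ∧ Bₘ ∧ B` becomes `H ∨ neg B₁ ∨ ⋯ ∨ neg Bₘ ← B`, where the `Bᵢ` are the body atoms
that contain a proper functional term. -/
def Clause.shift (C : Clause) : Clause :=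
  ⟨C.head ++ (C.body.filter fun A => A.isDeep).map Atom.neg, C.body.filter fun A => !A.isDeep⟩

/-- The clause `⊥ ← P(x₁, …, xₙ) ∧ neg P(x₁, …, xₙ)`. -/
def consistency (p : PredSym) : Clause := ⟨[], [genAtom p, (genAtom p).neg]⟩

/-- Basic shifting. -/
def bs (M : Set Clause) : Set Clause :=
  Clause.shift '' M ∪ {D | ∃ C ∈ M, ∃ A ∈ C.body, A.isDeep = true ∧ D = consistency A.pred}

/-- Shifting: partial flattening followed by basic shifting. -/
def sh (M : Set Clause) : Set Clause := bs (pf M)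

/-! ## Blocking -/

/-- The clause `x ≈ y ∨ x ≉ y ← B`, where `x` and `y` are the variables `0` and `1`. -/
def eqSplit (body : List Atom) : Clause :=
  ⟨[eqAtom (.var 0) (.var 1), (eqAtom (.var 0) (.var 1)).neg], body⟩

/-- The atom `p(t)` for a unary predicate symbol `p`. -/
def unaryAtom (p : PredSym) (t : Term) : Atom := ⟨p, fun _ => t⟩

/-- The unary predicate symbols of a clause set, other than `dom`. -/
def unarySyms (M : Set Clause) : Set PredSym :=
  {p | p ∈ predSyms M ∧ p.arity = 1 ∧ p ≠ PredSym.dom}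

/-- `sub(x, x) ← dom(x)`, and for every `n`-ary `f` and every `i` the clause
`sub(x, f(x₁, …, xₙ)) ← sub(x, xᵢ) ∧ dom(x) ∧ dom(f(x₁, …, xₙ))`. -/
def subAxioms (M : Set Clause) : Set Clause :=
  {⟨[subAtom (.var 0) (.var 0)], [domAtom (.var 0)]⟩} ∪
    {D | ∃ f ∈ funSyms M, ∃ i : Fin f.arity,
      D = ⟨[subAtom (.var 0) (genTerm f 1)],
        [subAtom (.var 0) (.var (1 + i)), domAtom (.var 0), domAtom (genTerm f 1)]⟩}

/-- Subterm domain blocking. -/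
def blsd (M : Set Clause) : Set Clause :=
  M ∪ subAxioms M ∪ {eqSplit [subAtom (.var 0) (.var 1)], consistency .eq}

/-- Subterm predicate blocking. -/
def blsp (M : Set Clause) : Set Clause :=
  M ∪ subAxioms M ∪
    {D | ∃ p ∈ unarySyms M,
      D = eqSplit [subAtom (.var 0) (.var 1), unaryAtom p (.var 0), unaryAtom p (.var 1)]} ∪
    {consistency .eq}

/-- Unrestricted domain blocking. -/
def blud (M : Set Clause) : Set Clause :=
  M ∪ {eqSplit [domAtom (.var 0), domAtom (.var 1)], consistency .eq}

/-- Unrestricted predicate blocking. -/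
def blup (M : Set Clause) : Set Clause :=
  M ∪ {D | ∃ p ∈ unarySyms M, D = eqSplit [unaryAtom p (.var 0), unaryAtom p (.var 1)]} ∪
    {consistency .eq}

/-! ## The combined transformations -/

inductive Restriction where
  | new : Restriction
  | classical : Restriction

def Restriction.apply : Restriction → ℕ → Set Clause → Set Clause
  | .new => rr
  | .classical => crr

inductive Blocking where
  | subtermDomain : Blocking
  | subtermPredicate : Blocking
  | unrestrictedDomain : Blocking
  | unrestrictedPredicate : Blocking

def Blocking.apply : Blocking → Set Clause → Set Clause
  | .subtermDomain => blsd
  | .subtermPredicate => blsp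
  | .unrestrictedDomain => blud
  | .unrestrictedPredicate => blup

/-- First shifting if `shift` is `true`, then the range-restricting transformation `r` with the
constant named `c`, then the blocking transformation `b`, if there is one. -/
def tr (shift : Bool) (r : Restriction) (b : Option Blocking) (c : ℕ) (M : Set Clause) :
    Set Clause :=
  let M₁ := if shift then sh M else M
  let M₂ := r.apply c M₁
  match b with
  | none => M₂
  | some τ => τ.apply M₂

/-- The clause `x ≈ x ← dom(x)`. -/
def domRefl : Clause := ⟨[eqAtom (.var 0) (.var 0)], [domAtom (.var 0)]⟩

/-! ## E-satisfiability -/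

/-- A first-order interpretation with domain `D`. -/
structure Interp (D : Type) where
  fn : (f : FunSym) → (Fin f.arity → D) → D
  rel : (p : PredSym) → (Fin p.arity → D) → Prop

/-- E-interpretations: the equality symbol is interpreted as identity. -/
def Interp.IsE {D : Type} (I : Interp D) : Prop :=
  ∀ a b : D, I.rel .eq (![a, b] : Fin 2 → D) ↔ a = b

def Interp.eval {D : Type} (I : Interp D) (μ : ℕ → D) : Term → D
  | .var x => μ x
  | .app f args => I.fn f fun i => I.eval μ (args i)

def Interp.SatAtom {D : Type} (I : Interp D) (μ : ℕ → D) (A : Atom) : Prop :=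
  I.rel A.pred fun i => I.eval μ (A.args i)

def Interp.SatClause {D : Type} (I : Interp D) (C : Clause) : Prop :=
  ∀ μ : ℕ → D, (∀ B ∈ C.body, I.SatAtom μ B) → ∃ H ∈ C.head, I.SatAtom μ H

/-- `M` has an E-model (with a nonempty domain). -/
def ESatisfiable (M : Set Clause) : Prop :=
  ∃ D : Type, Nonempty D ∧ ∃ I : Interp D, I.IsE ∧ ∀ C ∈ M, I.SatClause C

/-! ## Programs and their running time

Programs are finite systems of first-order recursive function definitions on binary trees with
numbers at the leaves (first-order pure LISP).  Every elementary operation takes one step: building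
and taking apart a pair, testing for a pair, and successor, equality test and comparison of
numbers. -/

inductive Data where
  | nat (n : ℕ) : Data
  | pair (a b : Data) : Data

def Data.fst : Data → Data
  | .nat _ => .nat 0
  | .pair a _ => a

def Data.snd : Data → Data
  | .nat _ => .nat 0
  | .pair _ b => b

def Data.succ : Data → Data
  | .nat n => .nat (n + 1)
  | .pair _ _ => .nat 0

def Data.isPair : Data → Data
  | .nat _ => .nat 0
  | .pair _ _ => .nat 1

/-- Equality test on numbers only: `1` for two equal numbers, and `0` otherwise. -/
def Data.natEq : Data → Data → Data
  | .nat m, .nat n => if m = n then .nat 1 else .nat 0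
  | _, _ => .nat 0

/-- Comparison of numbers: `1` for two numbers `m < n`, and `0` otherwise. -/
def Data.natLt : Data → Data → Data
  | .nat m, .nat n => if m < n then .nat 1 else .nat 0
  | _, _ => .nat 0

/-- Bodies of function definitions; `arg` is the argument of the function being defined, and
`call j e` applies the `j`-th function of the program to the value of `e`. -/
inductive Exp where
  | arg : Exp
  | const (n : ℕ) : Exp
  | pair (a b : Exp) : Exp
  | fst (a : Exp) : Exp
  | snd (a : Exp) : Exp
  | succ (a : Exp) : Exp
  | isPair (a : Exp) : Exp
  | natEq (a b : Exp) : Exp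
  | natLt (a b : Exp) : Exp
  | cond (a b e : Exp) : Exp
  | call (j : ℕ) (a : Exp) : Exp

/-- A program: the list of the bodies of its functions.  The function with index `0` is run. -/
abbrev Program := List Exp

/-- `Eval P x e v t`: in program `P`, with argument value `x`, the expression `e` is evaluated
(call by value) to `v` in exactly `t` steps. -/
inductive Eval (P : Program) : Data → Exp → Data → ℕ → Prop where
  | arg (x : Data) : Eval P x .arg x 1
  | const (x : Data) (n : ℕ) : Eval P x (.const n) (.nat n) 1
  | pair {x a b u v s t} : Eval P x a u s → Eval P x b v t →
      Eval P x (.pair a b) (.pair u v) (s + t + 1)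
  | fst {x a u s} : Eval P x a u s → Eval P x (.fst a) u.fst (s + 1)
  | snd {x a u s} : Eval P x a u s → Eval P x (.snd a) u.snd (s + 1)
  | succ {x a u s} : Eval P x a u s → Eval P x (.succ a) u.succ (s + 1)
  | isPair {x a u s} : Eval P x a u s → Eval P x (.isPair a) u.isPair (s + 1)
  | natEq {x a b u v s t} : Eval P x a u s → Eval P x b v t →
      Eval P x (.natEq a b) (u.natEq v) (s + t + 1)
  | natLt {x a b u v s t} : Eval P x a u s → Eval P x b v t →
      Eval P x (.natLt a b) (u.natLt v) (s + t + 1)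
  | condTrue {x a b e u v s t} : Eval P x a u s → u ≠ .nat 0 → Eval P x b v t →
      Eval P x (.cond a b e) v (s + t + 1)
  | condFalse {x a b e v s t} : Eval P x a (.nat 0) s → Eval P x e v t →
      Eval P x (.cond a b e) v (s + t + 1)
  | call {x j a body u v s t} : Eval P x a u s → P[j]? = some body → Eval P u body v t →
      Eval P x (.call j a) v (s + t + 1)

/-- Program `P` halts on the input `x` with the output `v` after `t` steps. -/
def Runs (P : Program) (x v : Data) (t : ℕ) : Prop := Eval P x (.call 0 .arg) v t

def encList : List Data → Data
  | [] => .nat 0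
  | d :: l => .pair d (encList l)

def FunSym.enc (f : FunSym) : Data := .pair (.nat f.name) (.nat f.arity)

def PredSym.enc : PredSym → Data
  | .eq => .pair (.nat 0) (.nat 0)
  | .user n k => .pair (.nat 1) (.pair (.nat n) (.nat k))
  | .dom => .pair (.nat 2) (.nat 0)
  | .sub => .pair (.nat 3) (.nat 0)
  | .neg p => .pair (.nat 4) p.enc

def Term.enc : Term → Data
  | .var x => .pair (.nat 0) (.nat x)
  | .app f args => .pair (.nat 1) (.pair f.enc (encList (List.ofFn fun i => (args i).enc)))

def Atom.enc (A : Atom) : Data := .pair A.pred.enc (encList (List.ofFn fun i => (A.args i).enc))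

def Clause.enc (C : Clause) : Data :=
  .pair (encList (C.head.map Atom.enc)) (encList (C.body.map Atom.enc))

/-- The input and output format for a finite clause set, listed in some order. -/
def encClauses (L : List Clause) : Data := encList (L.map Clause.enc)

/-! The size of a clause set is its number of occurrences of symbols (variables, function symbols
and predicate symbols, and one arrow for each clause). -/

def Term.size : Term → ℕ
  | .var _ => 1
  | .app _ args => 1 + ∑ i, (args i).size

def Atom.size (A : Atom) : ℕ := 1 + ∑ i, (A.args i).size

def Clause.size (C : Clause) : ℕ := 1 + (C.atoms.map Atom.size).sum

def clausesSize (L : List Clause) : ℕ := (L.map Clause.size).sum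

/-- The transformation `F`, which depends on the name `c` of a constant, can be computed in
quadratic time: given `c` and a list of the clauses of an input clause set `M`, a fixed program
outputs a list of the clauses of `F c M` in `O(n ^ 2)` steps, where `n` is the size of `M`. -/
def QuadraticTime (F : ℕ → Set Clause → Set Clause) : Prop :=
  ∃ (P : Program) (K : ℕ), ∀ (c : ℕ) (L : List Clause), IsInput {C | C ∈ L} →
    ∃ (N : List Clause) (t : ℕ),
      Runs P (.pair (.nat c) (encClauses L)) (encClauses N) t ∧
      {C | C ∈ N} = F c {C | C ∈ L} ∧
      t ≤ K * (clausesSize L) ^ 2 + K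

end BUMG

namespace BUMG

/-! ## Evaluation within a time bound -/

/-! Range restriction is syntactic. Restriction adds a `dom` atom for each head variable that the
body lacks. In all other generated clauses, those of blocking included, the head variables already
occur in the body.

Completeness is proved by undoing the steps in reverse order. Blocking and reflexivity only add
clauses, so they can be dropped. A model of the restricted set is cut down to the elements
satisfying `dom` (`Interp.relativize`), of which there is one because of dom(c); function values
outside `dom` are redirected to a fixed element of it. For `crr`, `dom` is closed under the
functions of M, so terms of M never meet a redirected value. For `rr`, `dom` need not be closed, but
if it contains f(a₁, …, aₙ) then it contains every aᵢ. Hence a term whose value in the old model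
lies in `dom` has the same value in the new one. The clauses dom(tᵢ) ← P(s₁, …, sₙ) and dom(xᵢ) ←
P(x₁, …, xₙ) put the arguments of true body atoms and true head atoms into `dom`. This is
`eSatisfiable_of_relativize` with its two applications, `eSatisfiable_of_crr` and
`eSatisfiable_of_rr`. Shifting is undone inside one interpretation: a fresh variable receives the
value of the term it replaces, and a consistency clause excludes that B and its negated copy hold
together (`eSatisfiable_of_sh`).

For the running time no program is written out as a whole. `InTime f T` says that a relocatable
program fragment computes f in O(T) steps; it is closed under pairing, composition, case distinction
and one loop scheme, `InTime.listRec`. Terms branch without bound, so one dedicated program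
(`nodesExp`) lists all subterm occurrences in linear time, and everything else is list processing.
Clauses are generated once per occurrence of a symbol; duplicates do no harm, because only the set
of output clauses matters. Quadratic cost arises inside single clauses and atoms, from searching and
removing duplicates in `Clause.restrict` and from the clauses dom(tᵢ) ← P(s₁, …, sₙ). These local
bounds add up to a global one because a sum of squares is at most the square of the sum. A computed
value can be reused at constant cost, so n clauses containing the same term of size n take only O(n)
steps. Finally, `setOf_trList` identifies the computed list with the transformation. -/

/-- The expression is evaluated to `v` in at most `T` steps. -/
def EvalLe (P : Program) (x : Data) (e : Exp) (v : Data) (T : ℕ) : Prop :=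
  ∃ t, t ≤ T ∧ Eval P x e v t

namespace EvalLe

variable {P : Program} {x u v : Data} {a b e : Exp} {s t T : ℕ}

theorem mono (h : EvalLe P x e v s) (hs : s ≤ t) : EvalLe P x e v t :=
  let ⟨r, hr, h⟩ := h
  ⟨r, hr.trans hs, h⟩

theorem arg : EvalLe P x .arg x 1 := ⟨1, le_rfl, .arg x⟩

theorem const (n : ℕ) : EvalLe P x (.const n) (.nat n) 1 := ⟨1, le_rfl, .const x n⟩

theorem pair (ha : EvalLe P x a u s) (hb : EvalLe P x b v t) :
    EvalLe P x (.pair a b) (.pair u v) (s + t + 1) :=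
  let ⟨_, hs, ha⟩ := ha
  let ⟨_, ht, hb⟩ := hb
  ⟨_, by omega, .pair ha hb⟩

theorem fst (ha : EvalLe P x a u s) : EvalLe P x (.fst a) u.fst (s + 1) :=
  let ⟨_, hs, ha⟩ := ha
  ⟨_, by omega, .fst ha⟩

theorem snd (ha : EvalLe P x a u s) : EvalLe P x (.snd a) u.snd (s + 1) :=
  let ⟨_, hs, ha⟩ := ha
  ⟨_, by omega, .snd ha⟩

theorem succ (ha : EvalLe P x a u s) : EvalLe P x (.succ a) u.succ (s + 1) :=
  let ⟨_, hs, ha⟩ := ha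
  ⟨_, by omega, .succ ha⟩

theorem isPair (ha : EvalLe P x a u s) : EvalLe P x (.isPair a) u.isPair (s + 1) :=
  let ⟨_, hs, ha⟩ := ha
  ⟨_, by omega, .isPair ha⟩

theorem natEq (ha : EvalLe P x a u s) (hb : EvalLe P x b v t) :
    EvalLe P x (.natEq a b) (u.natEq v) (s + t + 1) :=
  let ⟨_, hs, ha⟩ := ha
  let ⟨_, ht, hb⟩ := hb
  ⟨_, by omega, .natEq ha hb⟩

theorem natLt (ha : EvalLe P x a u s) (hb : EvalLe P x b v t) :
    EvalLe P x (.natLt a b) (u.natLt v) (s + t + 1) :=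
  let ⟨_, hs, ha⟩ := ha
  let ⟨_, ht, hb⟩ := hb
  ⟨_, by omega, .natLt ha hb⟩

theorem condTrue (ha : EvalLe P x a u s) (hu : u ≠ .nat 0) (hb : EvalLe P x b v t) :
    EvalLe P x (.cond a b e) v (s + t + 1) :=
  let ⟨_, hs, ha⟩ := ha
  let ⟨_, ht, hb⟩ := hb
  ⟨_, by omega, .condTrue ha hu hb⟩

theorem condFalse (ha : EvalLe P x a (.nat 0) s) (hb : EvalLe P x b v t) :
    EvalLe P x (.cond a e b) v (s + t + 1) :=
  let ⟨_, hs, ha⟩ := ha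
  let ⟨_, ht, hb⟩ := hb
  ⟨_, by omega, .condFalse ha hb⟩

theorem call {j : ℕ} {body : Exp} (ha : EvalLe P x a u s) (hj : P[j]? = some body)
    (hb : EvalLe P u body v t) : EvalLe P x (.call j a) v (s + t + 1) :=
  let ⟨_, hs, ha⟩ := ha
  let ⟨_, ht, hb⟩ := hb
  ⟨_, by omega, .call ha hj hb⟩

end EvalLe

/-! ## Functions computable within a time bound -/

/-- Types whose elements are represented by data. -/
class Coded (α : Type) where
  code : α → Data

open Coded (code)

instance : Coded Data := ⟨id⟩
instance : Coded ℕ := ⟨.nat⟩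
instance : Coded Bool := ⟨fun b => .nat b.toNat⟩
instance {α β : Type} [Coded α] [Coded β] : Coded (α × β) := ⟨fun p => .pair (code p.1) (code p.2)⟩
instance {α : Type} [Coded α] : Coded (List α) := ⟨fun l => encList (l.map code)⟩
instance : Coded FunSym := ⟨FunSym.enc⟩
instance : Coded PredSym := ⟨PredSym.enc⟩
instance : Coded Term := ⟨Term.enc⟩
instance : Coded Atom := ⟨Atom.enc⟩
instance : Coded Clause := ⟨Clause.enc⟩

/-- The function definitions `aux` are those of the program `P` from index `off` on. -/
def Located (off : ℕ) (aux : List Exp) (P : Program) : Prop :=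
  ∀ (j : ℕ) (e : Exp), aux[j]? = some e → P[off + j]? = some e

theorem Located.left {off : ℕ} {l m : List Exp} {P : Program} (h : Located off (l ++ m) P) :
    Located off l P := fun j e he => h j e <| by
  rw [List.getElem?_append_left (List.getElem?_eq_some_iff.1 he).1, he]

theorem Located.right {off : ℕ} {l m : List Exp} {P : Program} (h : Located off (l ++ m) P) :
    Located (off + l.length) m P := fun j e he => by
  rw [add_assoc]
  refine h _ e ?_
  rw [List.getElem?_append_right (by omega), Nat.add_sub_cancel_left, he]

theorem Located.head {off : ℕ} {e : Exp} {l : List Exp} {P : Program}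
    (h : Located off (e :: l) P) : P[off]? = some e := h 0 e rfl

theorem Located.tail {off : ℕ} {e : Exp} {l : List Exp} {P : Program}
    (h : Located off (e :: l) P) : Located (off + 1) l P := fun j e he => by
  rw [add_assoc, add_comm 1]
  exact h (j + 1) e he

/-- The function `f` is computed by a program fragment, which can be placed anywhere in a program,
in `O(T)` steps. -/
def InTime {α β : Type} [Coded α] [Coded β] (f : α → β) (T : α → ℕ) : Prop :=
  ∀ off : ℕ, ∃ (e : Exp) (aux : List Exp) (K : ℕ), ∀ P : Program, Located off aux P →
    ∀ a, EvalLe P (code a) e (code (f a)) (K * (T a + 1))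

/-- The value of a recursion along a list with an environment that is updated on the way. -/
def listRec {α β γ : Type} (base : α → γ) (upd : α → β → α) (step : α → β → γ → γ) :
    α → List β → γ
  | a, [] => base a
  | a, b :: l => step a b (listRec base upd step (upd a b) l)

/-- Map a function that also depends on the position, the positions being numbered from `k`. -/
def mapFrom {β γ : Type} (g : ℕ → β → γ) : ℕ → List β → List γ
  | _, [] => []
  | k, b :: l => g k b :: mapFrom g (k + 1) l

/-! ### Closure of time-bounded computability under the program constructs and list recursion. -/

namespace InTime

variable {α β γ δ : Type} [Coded α] [Coded β] [Coded γ] [Coded δ] {T T' S : α → ℕ}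

theorem mono {f : α → β} (h : InTime f T) (k : ℕ) (hT : ∀ a, T a ≤ k * (T' a + 1)) :
    InTime f T' := fun off => by
  obtain ⟨e, aux, K, h⟩ := h off
  refine ⟨e, aux, K * (k + 1), fun P hP a => (h P hP a).mono ?_⟩
  rw [mul_assoc]
  refine Nat.mul_le_mul_left K ?_
  have := hT a
  rw [add_mul]
  omega

theorem mono' {f : α → β} (h : InTime f T) (hT : ∀ a, T a ≤ T' a) : InTime f T' :=
  h.mono 1 fun a => by have := hT a; omega

/-- Programs see only codes. This lets an operation on raw data be read as one on syntax, for
instance the first component of a pair as the head of a clause. -/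
theorem retype {f : α → β} {g : α → γ} (h : InTime f T) (hfg : ∀ a, code (g a) = code (f a)) :
    InTime g T := fun off => by
  obtain ⟨e, aux, K, h⟩ := h off
  exact ⟨e, aux, K, fun P hP a => hfg a ▸ h P hP a⟩

theorem congr {f g : α → β} (h : InTime f T) (hfg : ∀ a, g a = f a) : InTime g T :=
  h.retype fun a => by rw [hfg]

/-- Changes of representation cost nothing. -/
theorem recode {f : α → β} (hf : ∀ a, code (f a) = code a) : InTime f T := fun _ =>
  ⟨.arg, [], 1, fun _ _ a => hf a ▸ EvalLe.arg.mono (by omega)⟩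

theorem id : InTime (fun a : α => a) T := recode fun _ => rfl

/-- The two fragments are laid out one behind the other, which is why fragments must exist for every
offset: calls use absolute indices. The other binary constructs follow the same pattern. -/
theorem pair {f : α → β} {g : α → γ} (hf : InTime f T) (hg : InTime g T) :
    InTime (fun a => (f a, g a)) T := fun off => by
  obtain ⟨e, aux, K, hf⟩ := hf off
  obtain ⟨e', aux', K', hg⟩ := hg (off + aux.length)
  refine ⟨.pair e e', aux ++ aux', K + K' + 1, fun P hP a =>
    ((hf P hP.left a).pair (hg P hP.right a)).mono ?_⟩
  simp only [add_mul]
  omega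

theorem fst {f : α → β × γ} (hf : InTime f T) : InTime (fun a => (f a).1) T := fun off => by
  obtain ⟨e, aux, K, hf⟩ := hf off
  refine ⟨.fst e, aux, K + 1, fun P hP a => (hf P hP a).fst.mono ?_⟩
  simp only [add_mul]
  omega

theorem snd {f : α → β × γ} (hf : InTime f T) : InTime (fun a => (f a).2) T := fun off => by
  obtain ⟨e, aux, K, hf⟩ := hf off
  refine ⟨.snd e, aux, K + 1, fun P hP a => (hf P hP a).snd.mono ?_⟩
  simp only [add_mul]
  omega

theorem dataFst {f : α → Data} (hf : InTime f T) : InTime (fun a => (f a).fst) T := fun off => by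
  obtain ⟨e, aux, K, hf⟩ := hf off
  refine ⟨.fst e, aux, K + 1, fun P hP a => (hf P hP a).fst.mono ?_⟩
  simp only [add_mul]
  omega

theorem dataSnd {f : α → Data} (hf : InTime f T) : InTime (fun a => (f a).snd) T := fun off => by
  obtain ⟨e, aux, K, hf⟩ := hf off
  refine ⟨.snd e, aux, K + 1, fun P hP a => (hf P hP a).snd.mono ?_⟩
  simp only [add_mul]
  omega

theorem dataNatEq {f g : α → Data} (hf : InTime f T) (hg : InTime g T) :
    InTime (fun a => (f a).natEq (g a)) T := fun off => by
  obtain ⟨e, aux, K, hf⟩ := hf off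
  obtain ⟨e', aux', K', hg⟩ := hg (off + aux.length)
  refine ⟨.natEq e e', aux ++ aux', K + K' + 1, fun P hP a =>
    ((hf P hP.left a).natEq (hg P hP.right a)).mono ?_⟩
  simp only [add_mul]
  omega

theorem dataNatLt {f g : α → Data} (hf : InTime f T) (hg : InTime g T) :
    InTime (fun a => (f a).natLt (g a)) T := fun off => by
  obtain ⟨e, aux, K, hf⟩ := hf off
  obtain ⟨e', aux', K', hg⟩ := hg (off + aux.length)
  refine ⟨.natLt e e', aux ++ aux', K + K' + 1, fun P hP a =>
    ((hf P hP.left a).natLt (hg P hP.right a)).mono ?_⟩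
  simp only [add_mul]
  omega

theorem succ {f : α → ℕ} (hf : InTime f T) : InTime (fun a => f a + 1) T := fun off => by
  obtain ⟨e, aux, K, hf⟩ := hf off
  refine ⟨.succ e, aux, K + 1, fun P hP a => (hf P hP a).succ.mono ?_⟩
  simp only [add_mul]
  omega

theorem natEq {f g : α → ℕ} (hf : InTime f T) (hg : InTime g T) :
    InTime (fun a => decide (f a = g a)) T :=
  (dataNatEq (f := fun a => code (f a)) (g := fun a => code (g a)) hf hg).retype fun a => by
    by_cases h : f a = g a <;> simp [code, Data.natEq, h]

theorem natLt {f g : α → ℕ} (hf : InTime f T) (hg : InTime g T) :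
    InTime (fun a => decide (f a < g a)) T :=
  (dataNatLt (f := fun a => code (f a)) (g := fun a => code (g a)) hf hg).retype fun a => by
    by_cases h : f a < g a <;> simp [code, Data.natLt, h]

theorem cond {b : α → Bool} {f g : α → β} (hb : InTime b T) (hf : InTime f T) (hg : InTime g T) :
    InTime (fun a => if b a then f a else g a) T := fun off => by
  obtain ⟨e₁, aux₁, K₁, hb⟩ := hb off
  obtain ⟨e₂, aux₂, K₂, hf⟩ := hf (off + aux₁.length)
  obtain ⟨e₃, aux₃, K₃, hg⟩ := hg (off + (aux₁ ++ aux₂).length)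
  refine ⟨.cond e₁ e₂ e₃, aux₁ ++ aux₂ ++ aux₃, K₁ + K₂ + K₃ + 1, fun P hP a => ?_⟩
  have h₁ := hb P hP.left.left a
  have h₂ := hf P hP.left.right a
  have h₃ := hg P hP.right a
  simp only [add_mul]
  cases h : b a
  · rw [h] at h₁
    simpa using (h₁.condFalse h₃).mono (by omega)
  · rw [h] at h₁
    simpa using (h₁.condTrue (by simp [code]) h₂).mono (by omega)

/-- Any fixed datum can be written as an expression; the cost depends on the datum alone and
disappears in the constant factor. -/
theorem const (b : β) : InTime (fun _ : α => b) T := fun off => by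
  have key : ∀ d : Data, ∃ (e : Exp) (K : ℕ), ∀ P x, EvalLe P x e d K := fun d => by
    induction d with
    | nat n => exact ⟨.const n, 1, fun P x => .const n⟩
    | pair a b ha hb =>
      obtain ⟨e, K, h⟩ := ha
      obtain ⟨e', K', h'⟩ := hb
      exact ⟨.pair e e', K + K' + 1, fun P x => (h P x).pair (h' P x)⟩
  obtain ⟨e, K, h⟩ := key (code b)
  refine ⟨e, [], K, fun P _ a => (h P _).mono ?_⟩
  rw [mul_add]
  omega

/-- The expression for g refers to its argument as `arg`, so it is made the body of a new function,
stored at the offset and called on the value of f. -/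
theorem comp {R : β → ℕ} {g : β → γ} {f : α → β} (hg : InTime g R) (hf : InTime f T) (k : ℕ)
    (hR : ∀ a, R (f a) ≤ k * (T a + 1)) : InTime (fun a => g (f a)) T := fun off => by
  obtain ⟨e, aux, K, hg⟩ := hg (off + 1)
  obtain ⟨e', aux', K', hf⟩ := hf (off + 1 + aux.length)
  refine ⟨.call off e', e :: (aux ++ aux'), K' + K * (k + 1) + 1, fun P hP a =>
    ((hf P hP.tail.right a).call hP.head (hg P hP.tail.left (f a))).mono ?_⟩
  have h : K * (R (f a) + 1) ≤ K * (k + 1) * (T a + 1) := by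
    rw [mul_assoc]
    refine Nat.mul_le_mul_left K ?_
    have := hR a
    rw [add_mul]
    omega
  rw [add_mul, add_mul]
  omega

theorem comp' {R : β → ℕ} {g : β → γ} {f : α → β} (hg : InTime g R) (hf : InTime f T)
    (hR : ∀ a, R (f a) ≤ T a) : InTime (fun a => g (f a)) T :=
  hg.comp hf 1 fun a => by have := hR a; omega

/-- The only source of loops over lists. Index `off` holds the loop, and the next three hold `base`,
`upd` and `step`. The hypotheses `hB` and `hC` say that C dominates the recurrence for the cost; the
summand 1 in `hC` pays for the bookkeeping of one round. -/
theorem listRec {base : α → γ} {upd : α → β → α} {step : α → β → γ → γ} {B : α → ℕ}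
    {U : α × β → ℕ} {S : α × β × γ → ℕ} {C : α × List β → ℕ} (hbase : InTime base B)
    (hupd : InTime (fun p : α × β => upd p.1 p.2) U)
    (hstep : InTime (fun p : α × β × γ => step p.1 p.2.1 p.2.2) S)
    (hB : ∀ a, B a ≤ C (a, []))
    (hC : ∀ a b l, U (a, b) + S (a, b, BUMG.listRec base upd step (upd a b) l) + C (upd a b, l) + 1
      ≤ C (a, b :: l)) :
    InTime (fun p : α × List β => BUMG.listRec base upd step p.1 p.2) C := fun off => by
  obtain ⟨e₁, aux₁, K₁, hbase⟩ := hbase (off + 1 + 1 + 1 + 1)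
  obtain ⟨e₂, aux₂, K₂, hupd⟩ := hupd (off + 1 + 1 + 1 + 1 + aux₁.length)
  obtain ⟨e₃, aux₃, K₃, hstep⟩ := hstep (off + 1 + 1 + 1 + 1 + (aux₁ ++ aux₂).length)
  refine ⟨.call off .arg, .cond (.isPair (.snd .arg))
    (.call (off + 1 + 1 + 1) (.pair (.fst .arg) (.pair (.fst (.snd .arg))
      (.call off (.pair (.call (off + 1 + 1) (.pair (.fst .arg) (.fst (.snd .arg))))
        (.snd (.snd .arg)))))))
    (.call (off + 1) (.fst .arg)) :: e₁ :: e₂ :: e₃ :: (aux₁ ++ aux₂ ++ aux₃),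
    K₁ + K₂ + K₃ + 40, fun P hP => ?_⟩
  have h₁ := hbase P hP.tail.tail.tail.tail.left.left
  have h₂ := hupd P hP.tail.tail.tail.tail.left.right
  have h₃ := hstep P hP.tail.tail.tail.tail.right
  rintro ⟨a, l⟩
  induction l generalizing a with
  | nil =>
    have ha : EvalLe P (code (a, ([] : List β))) (.fst .arg) (code a) 2 := EvalLe.arg.fst
    have hl : EvalLe P (code (a, ([] : List β))) (.isPair (.snd .arg)) (.nat 0) 3 :=
      EvalLe.arg.snd.isPair
    refine (EvalLe.arg.call hP.head (hl.condFalse (ha.call hP.tail.head (h₁ a)))).mono ?_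
    have h := Nat.mul_le_mul_left K₁ (Nat.add_le_add_right (hB a) 1)
    simp only [add_mul]
    omega
  | cons b l ih =>
    have ha : EvalLe P (code (a, b :: l)) (.fst .arg) (code a) 2 := EvalLe.arg.fst
    have hp : EvalLe P (code (a, b :: l)) (.isPair (.snd .arg)) (.nat 1) 3 :=
      EvalLe.arg.snd.isPair
    have hb : EvalLe P (code (a, b :: l)) (.fst (.snd .arg)) (code b) 3 := EvalLe.arg.snd.fst
    have hl : EvalLe P (code (a, b :: l)) (.snd (.snd .arg)) (code l) 3 := EvalLe.arg.snd.snd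
    obtain ⟨t, ht, h⟩ := ih (upd a b)
    -- The induction hypothesis speaks of a call on `arg`, but the recursive call has a compound
    -- argument. Inversion extracts the run of the loop body, which depends only on the value of the
    -- argument.
    cases h with
    | @call _ _ _ body _ _ s t hu hj hv =>
      cases hu
      rw [hP.head] at hj
      cases hj
      have hv' : EvalLe P (code (upd a b, l)) _ _ _ := ⟨t, le_rfl, hv⟩
      refine (EvalLe.arg.call hP.head (hp.condTrue (by simp) ((ha.pair (hb.pair
        ((((ha.pair hb).call hP.tail.tail.head (h₂ (a, b))).pair hl).call hP.head hv'))).call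
          hP.tail.tail.tail.head (h₃ (a, b, BUMG.listRec base upd step (upd a b) l))))).mono ?_
      -- One round costs about K₂(U + 1) + K₃(S + 1) plus fewer than 40 steps of overhead; the unit
      -- in `hC`, multiplied by K₁ + K₂ + K₃ + 40, covers all that is not proportional to U or S.
      refine le_trans ?_ (Nat.mul_le_mul_left _ (Nat.add_le_add_right (hC a b l) 1))
      have e₁ := Nat.le_mul_of_pos_right K₁ (Nat.succ_pos (U (a, b) +
        S (a, b, BUMG.listRec base upd step (upd a b) l)))
      simp only [add_mul, mul_add] at ht ⊢
      nlinarith [Nat.zero_le (K₁ * U (a, b)), Nat.zero_le (K₃ * U (a, b)),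
        Nat.zero_le (K₁ * S (a, b, BUMG.listRec base upd step (upd a b) l)),
        Nat.zero_le (K₂ * S (a, b, BUMG.listRec base upd step (upd a b) l))]

end InTime

/-! ## Lists -/

theorem listRec_const_upd {α β γ : Type} (base : α → γ) (step : α → β → γ → γ) (a : α)
    (l : List β) : listRec base (fun a _ => a) step a l = l.foldr (step a) (base a) := by
  induction l with
  | nil => rfl
  | cons b l ih => simp [listRec, ih]

theorem listRec_mapFrom {α β γ : Type} (g : α → ℕ → β → γ) (a : α) (k : ℕ) (l : List β) :
    listRec (fun _ => []) (fun (p : α × ℕ) _ => (p.1, p.2 + 1))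
      (fun p b r => g p.1 p.2 b :: r) (a, k) l = mapFrom (g a) k l := by
  induction l generalizing k with
  | nil => rfl
  | cons b l ih => simp [listRec, mapFrom, ih]

/-- The bridge from loops with a position counter to the `Fin`-indexed arguments of the syntax, such
as the variables numbered k + i. -/
theorem mapFrom_ofFn {β γ : Type} (g : ℕ → β → γ) (k : ℕ) {n : ℕ} (f : Fin n → β) :
    mapFrom g k (List.ofFn f) = List.ofFn fun i : Fin n => g (k + i) (f i) := by
  induction n generalizing k with
  | zero => rfl
  | succ n ih => simp [List.ofFn_succ, mapFrom, ih, add_assoc, add_comm 1]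

theorem dedup_eq_foldr (l : List ℕ) :
    l.dedup = l.foldr (fun x r => if decide (x ∈ r) then r else x :: r) [] := by
  induction l with
  | nil => rfl
  | cons x l ih =>
    rw [List.foldr_cons, ← ih]
    by_cases h : x ∈ l <;> simp [h]

theorem sum_map_mul_le (L : List ℕ) : (L.map fun x => x * x).sum ≤ L.sum * L.sum := by
  induction L with
  | nil => simp
  | cons x L ih =>
    simp only [List.map_cons, List.sum_cons]
    nlinarith [Nat.zero_le (x * L.sum)]

/-- Sums of squares are bounded by the squares of sums. -/
theorem sum_sq_le {β : Type} (l : List β) (f : β → ℕ) :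
    (l.map fun b => f b ^ 2).sum ≤ (l.map f).sum ^ 2 := by
  have := sum_map_mul_le (l.map f)
  simpa [Function.comp_def, sq] using this

theorem sum_map_le {β : Type} (l : List β) {f g : β → ℕ} (h : ∀ b ∈ l, f b ≤ g b) :
    (l.map f).sum ≤ (l.map g).sum := List.sum_le_sum h

theorem length_le_sum {β : Type} (l : List β) {f : β → ℕ} (h : ∀ b, 1 ≤ f b) :
    l.length ≤ (l.map f).sum := by
  have := sum_map_le l (f := fun _ => 1) (g := f) fun b _ => h b
  simpa using this

theorem sum_map_add {β : Type} (l : List β) (f g : β → ℕ) :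
    (l.map fun b => f b + g b).sum = (l.map f).sum + (l.map g).sum := by
  induction l with
  | nil => rfl
  | cons b l ih => simp only [List.map_cons, List.sum_cons, ih]; omega

theorem sum_map_mul {β : Type} (l : List β) (k : ℕ) (f : β → ℕ) :
    (l.map fun b => k * f b).sum = k * (l.map f).sum := by
  induction l with
  | nil => rfl
  | cons b l ih => simp only [List.map_cons, List.sum_cons, ih]; ring

theorem sum_map_flatMap {β γ : Type} (l : List β) (g : β → List γ) (f : γ → ℕ) :
    ((l.flatMap g).map f).sum = (l.map fun b => ((g b).map f).sum).sum := by
  induction l with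
  | nil => rfl
  | cons b l ih => simp [ih]

theorem sum_map_filter_le {β : Type} (l : List β) (p : β → Bool) (f : β → ℕ) :
    ((l.filter p).map f).sum ≤ (l.map f).sum := by
  induction l with
  | nil => simp
  | cons b l ih => cases h : p b <;> simp [h] <;> omega

theorem le_sum_of_mem {β : Type} {l : List β} {b : β} (h : b ∈ l) (f : β → ℕ) :
    f b ≤ (l.map f).sum := List.le_sum_of_mem (List.mem_map_of_mem h)

/-! ### Programs for list operations. -/

namespace InTime

variable {α β γ δ : Type} [Coded α] [Coded β] [Coded γ] [Coded δ] {T T' S : α → ℕ}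

theorem nil : InTime (fun _ : α => ([] : List β)) T := const []

theorem cons {f : α → β} {l : α → List β} (hf : InTime f T) (hl : InTime l T) :
    InTime (fun a => f a :: l a) T := (pair hf hl).retype fun _ => rfl

theorem not {b : α → Bool} (hb : InTime b T) : InTime (fun a => !b a) T :=
  (cond hb (const false) (const true)).congr fun a => by cases b a <;> rfl

theorem and {b c : α → Bool} (hb : InTime b T) (hc : InTime c T) :
    InTime (fun a => b a && c a) T :=
  (cond hb hc (const false)).congr fun a => by cases b a <;> rfl

theorem or {b c : α → Bool} (hb : InTime b T) (hc : InTime c T) :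
    InTime (fun a => b a || c a) T :=
  (cond hb (const true) hc).congr fun a => by cases b a <;> rfl

theorem foldr {l : α → List β} {start : α → γ} {G : α → β → γ → γ} {S : α → β → ℕ}
    (hl : InTime l T) (hstart : InTime start T)
    (hG : InTime (fun p : α × β × γ => G p.1 p.2.1 p.2.2) fun p => S p.1 p.2.1) :
    InTime (fun a => (l a).foldr (G a) (start a))
      fun a => T a + ((l a).map fun b => S a b + 1).sum := by
  have h := listRec (C := fun p : α × List β => T p.1 + (p.2.map fun b => S p.1 b + 1).sum)
    (U := fun _ => 0) hstart (upd := fun a _ => a) (fst id) hG (by simp)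
    (by intros; simp only [List.map_cons, List.sum_cons]; omega)
  refine (h.comp' (pair id (hl.mono' (T' := fun a => T a + ((l a).map fun b => S a b + 1).sum)
    (by simp))) fun a => le_rfl).congr fun a => ?_
  rw [listRec_const_upd]

theorem append {l m : α → List β} (hl : InTime l T) (hm : InTime m T) :
    InTime (fun a => l a ++ m a) fun a => T a + (l a).length := by
  refine ((foldr hl hm (S := fun _ _ => 0) (G := fun _ b r => b :: r)
    (cons (fst (snd id)) (snd (snd id)))).mono 1 fun a => by simp).congr fun a => ?_
  simp

theorem map {l : α → List β} {g : α → β → γ} {S : α → β → ℕ} (hl : InTime l T)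
    (hg : InTime (fun p : α × β => g p.1 p.2) fun p => S p.1 p.2) :
    InTime (fun a => (l a).map (g a)) fun a => T a + ((l a).map fun b => S a b + 1).sum := by
  refine (foldr hl (const []) (S := S) (G := fun a b r => g a b :: r)
    (cons ?_ (snd (snd id)))).congr fun a => ?_
  · exact hg.comp' (pair (fst id) (fst (snd id))) fun _ => le_rfl
  · induction l a with
    | nil => rfl
    | cons b l ih => rw [List.map_cons, List.foldr_cons, ih]

theorem filter {l : α → List β} {g : α → β → Bool} {S : α → β → ℕ} (hl : InTime l T)
    (hg : InTime (fun p : α × β => g p.1 p.2) fun p => S p.1 p.2) :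
    InTime (fun a => (l a).filter (g a)) fun a => T a + ((l a).map fun b => S a b + 1).sum := by
  refine (foldr hl (const []) (S := S) (G := fun a b r => if g a b then b :: r else r)
    (cond ?_ (cons (fst (snd id)) (snd (snd id))) (snd (snd id)))).congr fun a => ?_
  · exact hg.comp' (pair (fst id) (fst (snd id))) fun _ => le_rfl
  · induction l a with
    | nil => rfl
    | cons b l ih => simp [List.filter_cons, ih]

theorem any {l : α → List β} {g : α → β → Bool} {S : α → β → ℕ} (hl : InTime l T)
    (hg : InTime (fun p : α × β => g p.1 p.2) fun p => S p.1 p.2) :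
    InTime (fun a => (l a).any (g a)) fun a => T a + ((l a).map fun b => S a b + 1).sum := by
  refine (foldr hl (const false) (S := S) (G := fun a b r => g a b || r)
    (or ?_ (snd (snd id)))).congr fun a => ?_
  · exact hg.comp' (pair (fst id) (fst (snd id))) fun _ => le_rfl
  · induction l a with
    | nil => rfl
    | cons b l ih => simp [ih]

theorem flatMap {l : α → List β} {g : α → β → List γ} {S : α → β → ℕ} (hl : InTime l T)
    (hg : InTime (fun p : α × β => g p.1 p.2) fun p => S p.1 p.2) :
    InTime (fun a => (l a).flatMap (g a))
      fun a => T a + ((l a).map fun b => S a b + (g a b).length + 1).sum := by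
  refine (foldr hl (const []) (S := fun a b => S a b + (g a b).length)
    (G := fun a b r => g a b ++ r) ?_).congr fun a => ?_
  · have h : InTime (fun p : α × β × List γ => g p.1 p.2.1) fun p => S p.1 p.2.1 :=
      hg.comp' (pair (fst id) (fst (snd id))) fun _ => le_rfl
    exact append h (snd (snd id))
  · induction l a with
    | nil => rfl
    | cons b l ih => rw [List.flatMap_cons, List.foldr_cons, ih]

theorem flatten {l : α → List (List γ)} (hl : InTime l T) :
    InTime (fun a => (l a).flatten)
      fun a => T a + ((l a).map fun b => b.length + 1).sum := by
  refine ((flatMap hl (g := fun _ b => b) (S := fun _ _ => 0) (snd id)).mono' fun a => ?_).congr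
    fun a => ?_
  · simp
  · simp [List.flatMap_id']

theorem mapFrom {l : α → List β} {k : α → ℕ} {g : α → ℕ → β → γ} {S : α → β → ℕ}
    (hl : InTime l T) (hk : InTime k T)
    (hg : InTime (fun p : α × ℕ × β => g p.1 p.2.1 p.2.2) fun p => S p.1 p.2.2) :
    InTime (fun a => BUMG.mapFrom (g a) (k a) (l a))
      fun a => T a + ((l a).map fun b => S a b + 1).sum := by
  have h := listRec (C := fun p : (α × ℕ) × List β => (p.2.map fun b => S p.1.1 b + 1).sum)
    (B := fun _ => 0) (U := fun _ => 0) (S := fun p => S p.1.1 p.2.1) (base := fun _ => [])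
    (upd := fun (p : α × ℕ) _ => (p.1, p.2 + 1)) (step := fun p b r => g p.1 p.2 b :: r)
    nil (pair (fst (fst id)) (succ (snd (fst id))))
    (cons (hg.comp' (pair (fst (fst id)) (pair (snd (fst id)) (fst (snd id)))) fun _ => le_rfl)
      (snd (snd id))) (by simp)
    (by intros; simp only [List.map_cons, List.sum_cons]; omega)
  have hl' := hl.mono' (T' := fun a => T a + ((l a).map fun b => S a b + 1).sum) (by simp)
  have hk' := hk.mono' (T' := fun a => T a + ((l a).map fun b => S a b + 1).sum) (by simp)
  refine (h.comp' (pair (pair id hk') hl') fun a => by simp).congr fun a => ?_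
  rw [listRec_mapFrom]

/-- Addition is not elementary, so a length is added by one successor per entry. -/
theorem addLength {l : α → List β} {k : α → ℕ} (hl : InTime l T) (hk : InTime k T) :
    InTime (fun a => k a + (l a).length) fun a => T a + (l a).length := by
  refine ((foldr hl hk (S := fun _ _ => 0) (G := fun _ _ r => r + 1) (succ (snd (snd id)))).mono' ?_
    ).congr fun a => ?_
  · simp
  · induction l a with
    | nil => rfl
    | cons b l ih => simp [← ih, add_assoc]

theorem mem {l : α → List ℕ} {x : α → ℕ} (hx : InTime x T) (hl : InTime l T) :
    InTime (fun a => decide (x a ∈ l a)) fun a => T a + (l a).length := by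
  have h : InTime (fun p : ℕ × List ℕ => p.2.any fun y => decide (p.1 = y)) fun p => p.2.length :=
    (any (snd id) (S := fun _ _ => 0) (T := fun _ => 0) (g := fun p y => decide (p.1 = y))
      (natEq (fst (fst id)) (snd id))).mono' (by simp)
  have hp : InTime (fun a => (x a, l a)) fun a => T a + (l a).length :=
    (pair hx hl).mono' (by simp)
  refine (h.comp' hp (by simp)).congr fun a => ?_
  rw [Bool.eq_iff_iff]
  simp

/-- Each entry is searched in the already reduced tail, which is no longer than the tail itself; the
squares solve the recurrence because n + n² + 1 ≤ (n + 1)². -/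
theorem dedup {l : α → List ℕ} (hl : InTime l T) :
    InTime (fun a => (l a).dedup) fun a => T a + (l a).length ^ 2 := by
  have h := listRec (C := fun p : ℕ × List ℕ => p.2.length ^ 2)
    (B := fun _ => 0) (U := fun _ => 0) (S := fun p => p.2.2.length) (base := fun _ => [])
    (upd := fun a _ => a) (step := fun _ x r => if decide (x ∈ r) then r else x :: r)
    nil (fst id) (cond ((mem (T := fun _ => 0) (fst (snd id)) (snd (snd id))).mono' (by simp))
      (snd (snd id)) (cons (fst (snd id)) (snd (snd id)))) (by simp) ?_
  · have hp : InTime (fun a => ((0 : ℕ), l a)) fun a => T a + (l a).length ^ 2 :=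
      (pair (const 0) hl).mono' (by simp)
    refine (h.comp' hp (by simp)).congr fun a => ?_
    rw [listRec_const_upd, dedup_eq_foldr]
  · intro _ x l
    rw [listRec_const_upd, ← dedup_eq_foldr]
    have := (List.dedup_sublist l).length_le
    simp only [List.length_cons]
    nlinarith

theorem freshVar {l : α → List ℕ} (hl : InTime l T) :
    InTime (fun a => BUMG.freshVar (l a)) fun a => T a + (l a).length := by
  have h : InTime (fun p : α × ℕ × ℕ => if decide (p.2.1 + 1 < p.2.2) then p.2.2 else p.2.1 + 1)
      fun _ => 0 :=
    cond (natLt (succ (fst (snd id))) (snd (snd id))) (snd (snd id)) (succ (fst (snd id)))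
  refine ((foldr hl (const 0) (S := fun _ _ => 0)
    (G := fun _ x m => if decide (x + 1 < m) then m else x + 1) h).mono' (by simp)).congr
      fun a => ?_
  unfold BUMG.freshVar
  congr
  funext x m
  by_cases h : x + 1 < m
  · simp [h, h.le]
  · simp [h, not_lt.1 h]

end InTime

/-! ## Terms -/

/-- The list of the subterm occurrences of a term. -/
def Term.nodes : Term → List Term
  | .var x => [.var x]
  | .app f args => .app f args :: (List.ofFn fun i => (args i).nodes).flatten

/-- An occurrence of a function symbol, with its arguments. -/
structure App where
  fn : FunSym
  args : Fin fn.arity → Term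

instance : Coded App :=
  ⟨fun p => .pair p.fn.enc (encList (List.ofFn fun i => (p.args i).enc))⟩

def Atom.argList (A : Atom) : List Term := List.ofFn A.args

def App.argList (p : App) : List Term := List.ofFn p.args

theorem flatten_ofFn {β γ : Type} {n : ℕ} (f : Fin n → β) (g : β → List γ) :
    (List.ofFn fun i => g (f i)).flatten = (List.ofFn f).flatMap g := by
  rw [List.flatMap_def, List.map_ofFn, Function.comp_def]

theorem sum_univ_eq {β : Type} {n : ℕ} (f : Fin n → β) (g : β → ℕ) :
    ∑ i, g (f i) = ((List.ofFn f).map g).sum := by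
  rw [List.map_ofFn, List.sum_ofFn, Function.comp_def]

/-- The program that lists the subterm occurrences of a list of terms, in front of a given list. -/
def nodesExp (off : ℕ) : Exp :=
  .cond (.isPair (.fst .arg))
    (.pair (.fst (.fst .arg)) (.call off (.pair (.snd (.snd (.fst (.fst .arg))))
      (.call off (.pair (.snd (.fst .arg)) (.snd .arg))))))
    (.snd .arg)

theorem nodesExp_nil (P : Program) (off : ℕ) (acc : List Term) :
    EvalLe P (code (([] : List Term), acc)) (nodesExp off) (code acc) 20 :=
  EvalLe.mono (EvalLe.condFalse EvalLe.arg.fst.isPair EvalLe.arg.snd) (by omega)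

theorem nodesExp_cons {P : Program} {off : ℕ} (hP : P[off]? = some (nodesExp off)) {t : Term}
    {l m acc : List Term} {i j : ℕ} (ht : (code t).snd.snd = code m)
    (hl : EvalLe P (code (l, acc)) (nodesExp off) (code (l.flatMap Term.nodes ++ acc)) i)
    (hm : EvalLe P (code (m, l.flatMap Term.nodes ++ acc)) (nodesExp off)
      (code (m.flatMap Term.nodes ++ (l.flatMap Term.nodes ++ acc))) j) :
    EvalLe P (code (t :: l, acc)) (nodesExp off)
      (code (t :: (m.flatMap Term.nodes ++ (l.flatMap Term.nodes ++ acc)))) (i + j + 40) := by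
  have hp : EvalLe P (code (t :: l, acc)) (.isPair (.fst .arg)) (.nat 1) 3 := EvalLe.arg.fst.isPair
  have e₁ : EvalLe P (code (t :: l, acc)) (.fst (.fst .arg)) (code t) 3 := EvalLe.arg.fst.fst
  have e₂ : EvalLe P (code (t :: l, acc)) (.snd (.snd (.fst (.fst .arg)))) (code m) 5 :=
    ht ▸ e₁.snd.snd
  have e₃ : EvalLe P (code (t :: l, acc)) (.snd (.fst .arg)) (code l) 3 := EvalLe.arg.fst.snd
  have e₄ : EvalLe P (code (t :: l, acc)) (.snd .arg) (code acc) 2 := EvalLe.arg.snd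
  exact (hp.condTrue (by simp) (e₁.pair ((e₂.pair ((e₃.pair e₄).call hP hl)).call hP hm))).mono
    (by omega)

/-- The accumulator avoids concatenation, which keeps the time linear. The same function serves the
given list and the argument list of every term in it, so no mutual recursion is needed. -/
theorem nodesExp_eval {P : Program} {off : ℕ} (hP : P[off]? = some (nodesExp off)) :
    ∀ l acc : List Term, EvalLe P (code (l, acc)) (nodesExp off)
      (code (l.flatMap Term.nodes ++ acc)) (100 * (l.map Term.size).sum + 20) := by
  -- Terms are nested through lists. The claim for a list follows once each of its members may be
  -- put in front of any list for which the claim holds; this is used for the outer list and again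
  -- for the arguments of an application, and the rest is induction on the term.
  have of_step : ∀ l : List Term, (∀ t ∈ l, ∀ l : List Term,
      (∀ acc, EvalLe P (code (l, acc)) (nodesExp off) (code (l.flatMap Term.nodes ++ acc))
        (100 * (l.map Term.size).sum + 20)) →
      ∀ acc, EvalLe P (code (t :: l, acc)) (nodesExp off)
        (code ((t :: l).flatMap Term.nodes ++ acc)) (100 * ((t :: l).map Term.size).sum + 20)) →
      ∀ acc, EvalLe P (code (l, acc)) (nodesExp off) (code (l.flatMap Term.nodes ++ acc))
        (100 * (l.map Term.size).sum + 20) := fun l h => by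
    induction l with
    | nil => exact fun acc => (nodesExp_nil P off acc).mono (by omega)
    | cons t l ih =>
      exact h t List.mem_cons_self l (ih fun t ht => h t (List.mem_cons_of_mem _ ht))
  refine fun l => of_step l fun t ht => ?_
  clear ht
  induction t with
  | var x =>
    intro l hl acc
    -- For a variable, the second component of its code is a number, whose own second component
    -- defaults to 0. That is the code of the empty list, so a variable is treated as a term without
    -- arguments.
    exact (nodesExp_cons hP (t := .var x) (m := []) rfl (hl acc)
      (nodesExp_nil P off _)).mono (by simp [Term.size]; omega)
  | app f args ih =>
    intro l hl acc
    have hm := of_step (List.ofFn args) fun t ht => by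
      obtain ⟨i, rfl⟩ := (List.mem_ofFn' _ _).1 ht
      exact ih i
    have h := nodesExp_cons hP (t := .app f args) (m := List.ofFn args)
      (by simp [code, Term.enc, Data.snd, List.map_ofFn, Function.comp_def]) (hl acc) (hm _)
    rw [← List.append_assoc, ← List.cons_append, ← flatten_ofFn args Term.nodes] at h
    rw [List.flatMap_cons, List.append_assoc, Term.nodes, List.cons_append]
    rw [List.cons_append, List.append_assoc] at h
    refine h.mono ?_
    simp only [List.map_cons, List.sum_cons, Term.size, sum_univ_eq args Term.size]
    omega

namespace InTime

variable {α β γ δ : Type} [Coded α] [Coded β] [Coded γ] [Coded δ] {T T' S : α → ℕ}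

theorem termsNodes {l : α → List Term} (hl : InTime l T) :
    InTime (fun a => (l a).flatMap Term.nodes) fun a => T a + ((l a).map Term.size).sum := by
  have h : InTime (fun p : List Term × List Term => p.1.flatMap Term.nodes ++ p.2)
      fun p => (p.1.map Term.size).sum := fun off =>
    ⟨.call off .arg, [nodesExp off], 100, fun P hP p =>
      (EvalLe.arg.call hP.head (nodesExp_eval hP.head p.1 p.2)).mono (by dsimp only; omega)⟩
  have hp : InTime (fun a => (l a, ([] : List Term))) fun a => T a + ((l a).map Term.size).sum :=
    (pair hl nil).mono' (by simp)
  exact (h.comp' hp (by simp)).congr (by simp)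

end InTime

/-! ## Syntax: occurrences and sizes -/

theorem Term.size_pos (t : Term) : 1 ≤ t.size := by
  cases t <;> simp [Term.size]

theorem Atom.size_eq (A : Atom) : A.size = 1 + (A.argList.map Term.size).sum := by
  rw [Atom.size, sum_univ_eq A.args, Atom.argList]

theorem Atom.size_pos (A : Atom) : 1 ≤ A.size := by
  rw [Atom.size_eq]
  omega

theorem Clause.size_pos (C : Clause) : 1 ≤ C.size := by
  rw [Clause.size]
  omega

/-- The total size of a list of atoms. -/
def atomsSize (l : List Atom) : ℕ := (l.map Atom.size).sum

theorem atomsSize_cons (A : Atom) (l : List Atom) : atomsSize (A :: l) = A.size + atomsSize l := by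
  simp [atomsSize]

theorem atomsSize_append (l m : List Atom) : atomsSize (l ++ m) = atomsSize l + atomsSize m := by
  simp [atomsSize]

theorem Clause.size_eq (C : Clause) : C.size = 1 + atomsSize C.head + atomsSize C.body := by
  rw [Clause.size, Clause.atoms, ← atomsSize, atomsSize_append]
  omega

theorem length_le_atomsSize (l : List Atom) : l.length ≤ atomsSize l :=
  length_le_sum l Atom.size_pos

theorem Atom.length_argList_lt (A : Atom) : A.argList.length < A.size := by
  have := length_le_sum A.argList Term.size_pos
  rw [Atom.size_eq]
  omega

theorem Atom.length_argList (A : Atom) : A.argList.length = A.pred.arity := by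
  simp [Atom.argList]

theorem App.length_argList (p : App) : p.argList.length = p.fn.arity := by
  simp [App.argList]

theorem Atom.arity_lt (A : Atom) : A.pred.arity < A.size :=
  A.length_argList ▸ A.length_argList_lt

theorem Term.nodes_app (f : FunSym) (args : Fin f.arity → Term) :
    (Term.app f args).nodes = .app f args :: (List.ofFn args).flatMap Term.nodes := by
  rw [Term.nodes, flatten_ofFn args Term.nodes]

theorem Term.size_app (f : FunSym) (args : Fin f.arity → Term) :
    (Term.app f args).size = 1 + ((List.ofFn args).map Term.size).sum := by
  rw [Term.size, sum_univ_eq args]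

theorem length_flatMap_eq {β γ : Type} (l : List β) (g : β → List γ) :
    (l.flatMap g).length = (l.map fun b => (g b).length).sum := by
  rw [List.length_flatMap]

theorem forall_mem_ofFn {β : Type} {n : ℕ} {f : Fin n → β} {p : β → Prop} :
    (∀ b ∈ List.ofFn f, p b) ↔ ∀ i, p (f i) := by
  simp [List.mem_ofFn]

theorem Term.length_nodes (t : Term) : t.nodes.length = t.size := by
  induction t with
  | var x => rfl
  | app f args ih =>
    rw [Term.nodes_app, List.length_cons, length_flatMap_eq, Term.size_app, add_comm]
    congr 2
    exact List.map_congr_left (forall_mem_ofFn.2 ih)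

/-- The variable that the term is, if it is one. -/
def Term.varList : Term → List ℕ
  | .var x => [x]
  | .app _ _ => []

/-- The occurrence of a function symbol at the root of the term, if there is one. -/
def Term.appList : Term → List App
  | .var _ => []
  | .app f args => [⟨f, args⟩]

theorem Term.vars_eq (t : Term) : t.vars = t.nodes.flatMap Term.varList := by
  induction t with
  | var x => rfl
  | app f args ih =>
    rw [Term.nodes_app, Term.vars, flatten_ofFn args Term.vars, List.flatMap_cons,
      List.flatMap_assoc]
    exact List.flatMap_congr (forall_mem_ofFn.2 ih)

/-- The occurrences of function symbols in a term. -/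
def Term.apps (t : Term) : List App := t.nodes.flatMap Term.appList

theorem Term.apps_app (f : FunSym) (args : Fin f.arity → Term) :
    (Term.app f args).apps = ⟨f, args⟩ :: (List.ofFn args).flatMap Term.apps := by
  rw [Term.apps, Term.nodes_app, List.flatMap_cons, List.flatMap_assoc]
  rfl

theorem Term.funs_eq (t : Term) : t.funs = t.apps.map App.fn := by
  induction t with
  | var x => rfl
  | app f args ih =>
    rw [Term.apps_app, Term.funs, flatten_ofFn args Term.funs, List.map_cons, List.map_flatMap]
    congr 1
    exact List.flatMap_congr (forall_mem_ofFn.2 ih)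

/-- The arities add up to the number of occurrences of proper subterms, which is the size minus one,
and there are at most as many function occurrences as the size. So clauses generated at cost O(arity
+ 1) per occurrence cost linear time in all. -/
theorem Term.apps_size_lt (t : Term) : (t.apps.map fun p => p.fn.arity + 1).sum < 2 * t.size := by
  induction t with
  | var x => simp [Term.apps, Term.nodes, Term.appList, Term.size]
  | app f args ih =>
    rw [Term.apps_app, List.map_cons, List.sum_cons, Term.size_app, sum_map_flatMap]
    have h := sum_map_le (List.ofFn args) (forall_mem_ofFn (p := fun t : Term =>
      (t.apps.map fun p => p.fn.arity + 1).sum + 1 ≤ 2 * t.size).2 ih)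
    rw [sum_map_mul, sum_map_add] at h
    simp only [List.map_const', List.sum_replicate, List.length_ofFn, smul_eq_mul] at h
    dsimp only
    omega

theorem Atom.vars_eq (A : Atom) : A.vars = (A.argList.flatMap Term.nodes).flatMap Term.varList := by
  rw [Atom.vars, flatten_ofFn A.args Term.vars, List.flatMap_assoc, Atom.argList]
  exact List.flatMap_congr fun t _ => t.vars_eq

/-- The occurrences of function symbols in an atom. -/
def Atom.apps (A : Atom) : List App := (A.argList.flatMap Term.nodes).flatMap Term.appList

theorem Atom.apps_eq (A : Atom) : A.apps = A.argList.flatMap Term.apps := by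
  rw [Atom.apps, List.flatMap_assoc]
  rfl

theorem Atom.funs_eq (A : Atom) : A.funs = A.apps.map App.fn := by
  rw [Atom.funs, flatten_ofFn A.args Term.funs, Atom.apps_eq, List.map_flatMap, Atom.argList]
  exact List.flatMap_congr fun t _ => t.funs_eq

theorem Atom.apps_size_le (A : Atom) : (A.apps.map fun p => p.fn.arity + 1).sum ≤ 2 * A.size := by
  rw [Atom.apps_eq, sum_map_flatMap, Atom.size_eq]
  have h := sum_map_le A.argList fun t _ => t.apps_size_lt.le
  rw [sum_map_mul] at h
  omega

/-- The occurrences of function symbols in a clause. -/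
def Clause.apps (C : Clause) : List App := C.atoms.flatMap Atom.apps

theorem Clause.apps_size_le (C : Clause) :
    (C.apps.map fun p => p.fn.arity + 1).sum ≤ 2 * C.size := by
  rw [Clause.apps, sum_map_flatMap, Clause.size]
  have h := sum_map_le C.atoms fun A _ => A.apps_size_le
  rw [sum_map_mul] at h
  omega

theorem Term.length_vars_le (t : Term) : t.vars.length ≤ t.size := by
  rw [Term.vars_eq, length_flatMap_eq, ← Term.length_nodes]
  refine (sum_map_le _ (g := fun _ => 1) fun t _ => ?_).trans (by simp)
  cases t <;> simp [Term.varList]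

theorem Atom.length_vars_le (A : Atom) : A.vars.length ≤ A.size := by
  rw [Atom.vars, flatten_ofFn A.args Term.vars, length_flatMap_eq, Atom.size_eq]
  exact (sum_map_le _ fun t _ => t.length_vars_le).trans (by rw [Atom.argList]; omega)

theorem length_atomsVars_le (l : List Atom) : (atomsVars l).length ≤ atomsSize l := by
  rw [atomsVars, length_flatMap_eq]
  exact sum_map_le _ fun A _ => A.length_vars_le

namespace InTime

variable {α β γ δ : Type} [Coded α] [Coded β] [Coded γ] [Coded δ] {T T' S : α → ℕ}

/-! ## Programs for terms, atoms and clauses -/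

theorem head {f : α → Clause} (hf : InTime f T) : InTime (fun a => (f a).head) T :=
  (dataFst (f := fun a => code (f a)) hf).retype fun _ => rfl

theorem body {f : α → Clause} (hf : InTime f T) : InTime (fun a => (f a).body) T :=
  (dataSnd (f := fun a => code (f a)) hf).retype fun _ => rfl

theorem clause {h b : α → List Atom} (hh : InTime h T) (hb : InTime b T) :
    InTime (fun a => (⟨h a, b a⟩ : Clause)) T :=
  (pair hh hb).retype fun _ => rfl

theorem pred {f : α → Atom} (hf : InTime f T) : InTime (fun a => (f a).pred) T :=
  (dataFst (f := fun a => code (f a)) hf).retype fun _ => rfl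

theorem argList {f : α → Atom} (hf : InTime f T) : InTime (fun a => (f a).argList) T :=
  (dataSnd (f := fun a => code (f a)) hf).retype fun _ => by
    simp [code, Atom.enc, Atom.argList, Data.snd, List.map_ofFn, Function.comp_def]

/-- The dependently typed argument function of an atom is coded as a plain list, so computing the
predicate symbol and that list suffices. -/
theorem atom {A : α → Atom} {p : α → PredSym} {l : α → List Term} (hp : InTime p T)
    (hl : InTime l T) (h₁ : ∀ a, (A a).pred = p a) (h₂ : ∀ a, (A a).argList = l a) :
    InTime A T :=
  (pair hp hl).retype fun a => by
    simp [← h₁, ← h₂, code, Atom.enc, Atom.argList, List.map_ofFn, Function.comp_def]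

theorem appFn {f : α → App} (hf : InTime f T) : InTime (fun a => (f a).fn) T :=
  (dataFst (f := fun a => code (f a)) hf).retype fun _ => rfl

theorem appArgList {f : α → App} (hf : InTime f T) : InTime (fun a => (f a).argList) T :=
  (dataSnd (f := fun a => code (f a)) hf).retype fun _ => by
    simp [code, App.argList, Data.snd, List.map_ofFn, Function.comp_def]

theorem var {k : α → ℕ} (hk : InTime k T) : InTime (fun a => Term.var (k a)) T :=
  (pair (const 0) hk).retype fun _ => rfl

theorem isVar {t : α → Term} (ht : InTime t T) : InTime (fun a => (t a).isVar) T :=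
  (dataNatEq (dataFst (f := fun a => code (t a)) ht) (const (.nat 0))).retype fun a => by
    cases t a <;> rfl

theorem isProper {t : α → Term} (ht : InTime t T) : InTime (fun a => (t a).isProper) T :=
  (dataNatLt (const (.nat 0)) (dataSnd (dataFst (dataSnd (f := fun a => code (t a)) ht)))).retype
    fun a => by
      cases t a with
      | var x => rfl
      | app f args =>
        by_cases h : 0 < f.arity <;>
          simp [code, Term.isProper, Term.enc, FunSym.enc, Data.fst, Data.snd, Data.natLt, h]

theorem isEq {p : α → PredSym} (hp : InTime p T) : InTime (fun a => (p a).isEq) T :=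
  (dataNatEq (dataFst (f := fun a => code (p a)) hp) (const (.nat 0))).retype fun a => by
    cases p a <;> rfl

theorem negSym {p : α → PredSym} (hp : InTime p T) : InTime (fun a => PredSym.neg (p a)) T :=
  (pair (const 4) hp).retype fun _ => rfl

theorem neg {A : α → Atom} (hA : InTime A T) : InTime (fun a => (A a).neg) T :=
  atom (negSym (pred hA)) (argList hA) (fun _ => rfl) fun _ => rfl

theorem eqAtom {s t : α → Term} (hs : InTime s T) (ht : InTime t T) :
    InTime (fun a => BUMG.eqAtom (s a) (t a)) T :=
  atom (const .eq) (cons hs (cons ht nil)) (fun _ => rfl) fun _ => rfl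

theorem subAtom {s t : α → Term} (hs : InTime s T) (ht : InTime t T) :
    InTime (fun a => BUMG.subAtom (s a) (t a)) T :=
  atom (const .sub) (cons hs (cons ht nil)) (fun _ => rfl) fun _ => rfl

theorem domAtom {t : α → Term} (ht : InTime t T) : InTime (fun a => BUMG.domAtom (t a)) T :=
  atom (const .dom) (cons ht nil) (fun _ => rfl) fun _ => rfl

theorem varList {t : α → Term} (ht : InTime t T) : InTime (fun a => (t a).varList) T :=
  (cond (isVar ht) (cons (dataSnd (f := fun a => code (t a)) ht) nil) nil).retype fun a => by
    cases t a <;> rfl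

theorem appList {t : α → Term} (ht : InTime t T) : InTime (fun a => (t a).appList) T :=
  (cond (isVar ht) nil (cons (dataSnd (f := fun a => code (t a)) ht) nil)).retype fun a => by
    cases t a with
    | var x => rfl
    | app f args =>
      simp [Term.isVar, code, Term.appList, Term.enc, Data.snd]

theorem atomNodes : InTime (fun A : Atom => A.argList.flatMap Term.nodes) Atom.size :=
  (termsNodes (argList id) (T := fun _ => 0)).mono' fun A => by rw [Atom.size_eq]; omega

theorem length_atomNodes_le (A : Atom) : (A.argList.flatMap Term.nodes).length ≤ A.size := by
  rw [length_flatMap_eq, Atom.size_eq]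
  simp [Term.length_nodes]

theorem vars : InTime Atom.vars Atom.size := by
  refine ((flatMap atomNodes (g := fun _ t => t.varList) (S := fun _ _ => 0)
    (varList (snd id))).mono 3 fun A => ?_).congr fun A => A.vars_eq
  have h := sum_map_le (A.argList.flatMap Term.nodes)
    (f := fun t => 0 + t.varList.length + 1) (g := fun _ => 2)
    fun t _ => by cases t <;> simp [Term.varList]
  have := length_atomNodes_le A
  simp only [List.map_const', List.sum_replicate, smul_eq_mul] at h
  omega

theorem apps : InTime Atom.apps Atom.size := by
  refine (flatMap atomNodes (g := fun _ t => t.appList) (S := fun _ _ => 0)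
    (appList (snd id))).mono 3 fun A => ?_
  have h := sum_map_le (A.argList.flatMap Term.nodes)
    (f := fun t => 0 + t.appList.length + 1) (g := fun _ => 2)
    fun t _ => by cases t <;> simp [Term.appList]
  have := length_atomNodes_le A
  simp only [List.map_const', List.sum_replicate, smul_eq_mul] at h
  omega

theorem atomsVars : InTime BUMG.atomsVars atomsSize := by
  refine (flatMap id (T := fun _ => 0) (g := fun _ A => Atom.vars A)
    (S := fun _ A => Atom.size A)
    (vars.comp' (snd id) fun _ => le_rfl)).mono 3 fun l => ?_
  have h := sum_map_le l (f := fun A : Atom => A.size + A.vars.length + 1) (g := fun A => 3 * A.size)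
    fun A _ => by have := A.size_pos; have := A.length_vars_le; omega
  rw [sum_map_mul, ← atomsSize] at h
  omega

theorem atoms : InTime Clause.atoms Clause.size :=
  (append (head id) (body id) (T := fun _ => 0)).mono' fun C => by
    have := length_le_atomsSize C.head
    have := C.size_eq
    omega

theorem clauseApps : InTime Clause.apps Clause.size := by
  refine (flatMap atoms (g := fun _ A => A.apps) (S := fun _ A => A.size)
    (apps.comp' (snd id) fun _ => le_rfl)).mono 5 fun C => ?_
  have h := sum_map_le C.atoms (f := fun A => A.size + A.apps.length + 1)
    (g := fun A => 4 * A.size) fun A _ => by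
      have := A.size_pos
      have := (length_le_sum _ fun p : App => Nat.le_add_left 1 p.fn.arity).trans A.apps_size_le
      omega
  rw [sum_map_mul] at h
  have : C.size = 1 + (C.atoms.map Atom.size).sum := rfl
  omega

theorem isDeep : InTime Atom.isDeep Atom.size := by
  refine ((any (argList id) (T := fun _ => 0) (g := fun _ t => t.isProper) (S := fun _ _ => 0)
    (isProper (snd id))).mono 1 fun A => ?_).congr fun A => ?_
  · have := A.length_argList_lt
    simp
    omega
  · have h : (List.ofFn fun i => (A.args i).isProper) = A.argList.map Term.isProper := by
      rw [Atom.argList, List.map_ofFn, Function.comp_def]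
    rw [Atom.isDeep, h, List.any_map]
    rfl

/-! ## Restriction -/

/-- Each head variable is searched among the body variables, and duplicates are removed among head
variables only. Keeping the head as a separate factor is essential for `domTerms`: there many
clauses with small heads share one large body atom, and the bound |C|² per clause would add up to a
cubic one. -/
theorem headOnlyVars :
    InTime Clause.headOnlyVars fun C => (atomsSize C.head + 1) * C.size := by
  have h₁ : InTime (fun C : Clause => BUMG.atomsVars C.head) Clause.size :=
    atomsVars.comp' (head id) fun C => by rw [C.size_eq]; omega
  have h₂ : InTime (fun C : Clause => BUMG.atomsVars C.body) Clause.size :=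
    atomsVars.comp' (body id) fun C => by rw [C.size_eq]; omega
  have h₃ : InTime (fun p : Clause × ℕ => !decide (p.2 ∈ BUMG.atomsVars p.1.body))
      fun p => p.1.size := by
    refine (not (mem (snd id) (h₂.comp' (fst id) fun _ => le_rfl))).mono 2 fun p => ?_
    have := length_atomsVars_le p.1.body
    have := p.1.size_eq
    omega
  refine ((dedup (filter (g := fun C x => !decide (x ∈ BUMG.atomsVars C.body))
    (S := fun C _ => C.size) h₁ h₃)).mono 4 fun C => ?_).congr fun C => ?_
  · have h₄ := length_atomsVars_le C.head
    have h₅ := (List.length_filter_le (fun x => !decide (x ∈ BUMG.atomsVars C.body))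
      (BUMG.atomsVars C.head)).trans h₄
    have h₆ := C.size_eq
    have h₇ : atomsSize C.head * (C.size + 1) ≤ atomsSize C.head * (2 * C.size) :=
      Nat.mul_le_mul_left _ (by omega)
    have h₈ := Nat.mul_le_mul_right (C.size + 1) h₄
    have h₉ := Nat.pow_le_pow_left h₅ 2
    have h₁₀ : atomsSize C.head * atomsSize C.head ≤ atomsSize C.head * C.size :=
      Nat.mul_le_mul_left _ (by omega)
    simp only [List.map_const', List.sum_replicate, smul_eq_mul]
    nlinarith
  · simp [Clause.headOnlyVars]

theorem length_headOnlyVars_le (C : Clause) : C.headOnlyVars.length ≤ atomsSize C.head :=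
  ((List.dedup_sublist _).length_le.trans (List.length_filter_le _ _)).trans
    (length_atomsVars_le _)

theorem restrict : InTime Clause.restrict fun C => (atomsSize C.head + 1) * C.size := by
  have h : InTime (fun C : Clause => C.headOnlyVars.map fun x => BUMG.domAtom (.var x))
      fun C => (atomsSize C.head + 1) * C.size := by
    refine (map headOnlyVars (g := fun _ x => BUMG.domAtom (.var x)) (S := fun _ _ => 0)
      (domAtom (var (snd id)))).mono 2 fun C => ?_
    have h₁ := length_headOnlyVars_le C
    have h₂ := C.size_pos
    simp
    nlinarith
  refine clause (head id) ((append (body id) h).mono 2 fun C => ?_)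
  have h₁ := length_le_atomsSize C.body
  have h₂ := C.size_eq
  nlinarith

/-! ## Shifting -/

theorem flat : InTime (fun p : ℕ × Atom => p.2.flat p.1) fun p => p.2.size := by
  have h : InTime (fun p : ℕ × Atom => BUMG.mapFrom
      (fun k t => if t.isProper then Term.var k else t) p.1 p.2.argList) fun p => p.2.size := by
    refine (mapFrom (argList (snd id)) (fst id) (T := fun _ => 0)
      (g := fun _ k t => if t.isProper then Term.var k else t) (S := fun _ _ => 0)
      (cond (isProper (snd (snd id))) (var (fst (snd id))) (snd (snd id)))).mono 1 fun p => ?_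
    have := p.2.length_argList_lt
    simp
    omega
  refine (cond (isEq (pred (snd id))) (snd id) (atom (A := fun p : ℕ × Atom => ⟨p.2.pred, fun i =>
      if (p.2.args i).isProper then .var (p.1 + i) else p.2.args i⟩)
    (pred (snd id)) h (fun _ => rfl) fun p => ?_)).congr fun p => rfl
  rw [Atom.argList, Atom.argList, mapFrom_ofFn]

theorem flatEqs : InTime (fun p : ℕ × Atom => p.2.flatEqs p.1) fun p => p.2.size := by
  have h : InTime (fun p : ℕ × Atom => BUMG.mapFrom
      (fun k t => if t.isProper then [BUMG.eqAtom t (.var k)] else []) p.1 p.2.argList)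
      fun p => p.2.size := by
    refine (mapFrom (argList (snd id)) (fst id) (T := fun _ => 0)
      (g := fun _ k t => if t.isProper then [BUMG.eqAtom t (.var k)] else []) (S := fun _ _ => 0)
      (cond (isProper (snd (snd id))) (cons (eqAtom (snd (snd id)) (var (fst (snd id)))) nil)
        nil)).mono 1 fun p => ?_
    have := p.2.length_argList_lt
    simp
    omega
  refine ((cond (isEq (pred (snd id))) nil (flatten h)).mono 4 fun p => ?_).congr fun p => ?_
  · rw [Atom.argList, mapFrom_ofFn, List.map_ofFn, List.sum_ofFn]
    have h := Finset.sum_le_card_nsmul (Finset.univ : Finset (Fin p.2.pred.arity))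
      ((fun b : List Atom => b.length + 1) ∘ fun i =>
        if (p.2.args i).isProper then [BUMG.eqAtom (p.2.args i) (.var (p.1 + i))] else []) 2
      fun i _ => by by_cases h : (p.2.args i).isProper <;> simp [h]
    have := p.2.arity_lt
    simp only [Finset.card_univ, Fintype.card_fin, smul_eq_mul] at h
    refine (Nat.add_le_add_left h _).trans ?_
    omega
  · rw [Atom.argList, mapFrom_ofFn, Atom.flatEqs]

theorem length_flatEqs_le (k : ℕ) (A : Atom) : (A.flatEqs k).length ≤ A.size := by
  rw [Atom.flatEqs]
  split_ifs
  · simp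
  · rw [List.length_flatten, List.map_ofFn, List.sum_ofFn]
    refine (Finset.sum_le_card_nsmul (Finset.univ : Finset (Fin A.pred.arity)) _ 1 fun i _ => ?_
      ).trans ?_
    · by_cases h : (A.args i).isProper <;> simp [h]
    · simpa using A.arity_lt.le

theorem listRec_flatAtoms (k : ℕ) (l : List Atom) :
    BUMG.listRec (fun _ => []) (fun k A => k + A.pred.arity) (fun k A r => A.flat k :: r) k l =
      BUMG.flatAtoms k l := by
  induction l generalizing k with
  | nil => rfl
  | cons A l ih => rw [BUMG.listRec, ih, BUMG.flatAtoms]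

theorem listRec_flatAtomsEqs (k : ℕ) (l : List Atom) :
    BUMG.listRec (fun _ => []) (fun k A => k + A.pred.arity) (fun k A r => A.flatEqs k ++ r) k l =
      BUMG.flatAtomsEqs k l := by
  induction l generalizing k with
  | nil => rfl
  | cons A l ih => rw [BUMG.listRec, ih, BUMG.flatAtomsEqs]

/-- The arity is obtained as the length of the argument list, uniformly for all predicate symbols.
-/
theorem addArity : InTime (fun p : ℕ × Atom => p.1 + p.2.pred.arity) fun p => p.2.size :=
  ((addLength (argList (snd id)) (fst id) (T := fun _ => 0)).mono' fun p => by
    have := p.2.length_argList_lt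
    omega).congr fun p => by rw [Atom.length_argList]

theorem flatAtoms : InTime (fun p : ℕ × List Atom => BUMG.flatAtoms p.1 p.2)
    fun p => atomsSize p.2 :=
  ((listRec (C := fun p : ℕ × List Atom => 3 * atomsSize p.2) (B := fun _ => 0)
    (U := fun p => p.2.size) (base := fun _ => []) (step := fun k A r => A.flat k :: r) (S := fun p => p.2.1.size) nil
    addArity (cons (flat.comp' (pair (fst id) (fst (snd id))) fun _ => le_rfl) (snd (snd id)))
    (by simp) fun k A l => by
      have := A.size_pos
      simp only [atomsSize_cons]
      omega).mono 3 (by intro; omega)).congr fun p => by rw [listRec_flatAtoms]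

theorem flatAtomsEqs : InTime (fun p : ℕ × List Atom => BUMG.flatAtomsEqs p.1 p.2)
    fun p => atomsSize p.2 :=
  ((listRec (C := fun p : ℕ × List Atom => 4 * atomsSize p.2) (B := fun _ => 0)
    (U := fun p => p.2.size) (base := fun _ => []) (step := fun k A r => A.flatEqs k ++ r)
    (S := fun p => p.2.1.size + (p.2.1.flatEqs p.1).length) nil
    addArity (append (flatEqs.comp' (pair (fst id) (fst (snd id))) fun _ => le_rfl) (snd (snd id)))
    (by simp) fun k A l => by
      have := A.size_pos
      have := length_flatEqs_le k A
      simp only [atomsSize_cons]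
      omega).mono 4 (by intro; omega)).congr fun p => by rw [listRec_flatAtomsEqs]

theorem length_flatAtoms (k : ℕ) (l : List Atom) : (BUMG.flatAtoms k l).length = l.length := by
  induction l generalizing k with
  | nil => rfl
  | cons A l ih => simp [BUMG.flatAtoms, ih]

theorem flattenClause : InTime Clause.flatten Clause.size := by
  have h₁ : InTime (fun C : Clause => BUMG.freshVar C.vars) Clause.size :=
    (freshVar (atomsVars.comp' atoms fun C => by rw [Clause.size, ← atomsSize]; omega)).mono 2
      fun C => by
        have := length_atomsVars_le C.atoms
        have h : C.size = 1 + atomsSize C.atoms := rfl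
        omega
  have h₂ : InTime (fun C : Clause => BUMG.flatAtoms (BUMG.freshVar C.vars) C.body) Clause.size :=
    flatAtoms.comp' (pair h₁ (body id)) fun C => by dsimp only; rw [C.size_eq]; omega
  have h₃ : InTime (fun C : Clause => BUMG.flatAtomsEqs (BUMG.freshVar C.vars) C.body) Clause.size :=
    flatAtomsEqs.comp' (pair h₁ (body id)) fun C => by dsimp only; rw [C.size_eq]; omega
  refine clause (head id) ((append h₂ h₃).mono 2 fun C => ?_)
  have := length_le_atomsSize C.body
  have := C.size_eq
  rw [length_flatAtoms]
  omega

theorem shift : InTime Clause.shift Clause.size := by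
  have h₁ : InTime (fun C : Clause => C.body.filter fun A => A.isDeep) Clause.size := by
    refine (filter (body id) (T := fun _ => 0) (S := fun _ A => A.size)
      (g := fun _ A => A.isDeep) (isDeep.comp' (snd id) fun _ => le_rfl)).mono 2 fun C => ?_
    have h₁ := length_le_atomsSize C.body
    have h₂ := C.size_eq
    rw [sum_map_add, ← atomsSize]
    simp
    omega
  have h₂ : InTime (fun C : Clause => C.body.filter fun A => !A.isDeep) Clause.size := by
    refine (filter (body id) (T := fun _ => 0) (S := fun _ A => A.size)
      (g := fun _ A => !A.isDeep) (not (isDeep.comp' (snd id) fun _ => le_rfl))).mono 2 fun C => ?_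
    have h₁ := length_le_atomsSize C.body
    have h₂ := C.size_eq
    rw [sum_map_add, ← atomsSize]
    simp
    omega
  have h₃ : InTime (fun C : Clause => (C.body.filter fun A => A.isDeep).map Atom.neg)
      Clause.size := by
    refine (map h₁ (g := fun _ A => A.neg) (S := fun _ _ => 0) (neg (snd id))).mono 2 fun C => ?_
    have h₁ := length_le_atomsSize C.body
    have h₂ := C.size_eq
    have h₃ := List.length_filter_le (fun A : Atom => A.isDeep) C.body
    simp
    omega
  refine clause ((append (head id) h₃).mono 2 fun C => ?_) h₂
  have := length_le_atomsSize C.head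
  have := C.size_eq
  omega

theorem genAtom : InTime (fun A : Atom => BUMG.genAtom A.pred) Atom.size := by
  refine atom (pred id) ((mapFrom (argList id) (const 0) (T := fun _ => 0)
    (g := fun _ k _ => Term.var k) (S := fun _ _ => 0) (var (fst (snd id)))).mono 1 fun A => ?_)
    (fun _ => rfl) fun A => ?_
  · have := A.length_argList_lt
    simp
    omega
  · rw [Atom.argList, Atom.argList, mapFrom_ofFn]
    simp [BUMG.genAtom]

theorem consistency : InTime (fun A : Atom => BUMG.consistency A.pred) Atom.size :=
  clause nil (cons genAtom (cons (neg genAtom) nil))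

end InTime

/-! ## The generated clauses -/

/-- `dom(f(x₁, …, xₙ)) ← dom(x₁) ∧ ⋯ ∧ dom(xₙ)` -/
def App.domClosure (p : App) : Clause :=
  ⟨[domAtom (genTerm p.fn 0)], List.ofFn fun i : Fin p.fn.arity => domAtom (.var i)⟩

/-- The clauses `dom(xᵢ) ← dom(f(x₁, …, xₙ))`. -/
def App.domArgs (p : App) : List Clause :=
  List.ofFn fun i : Fin p.fn.arity => ⟨[domAtom (.var i)], [domAtom (genTerm p.fn 0)]⟩

/-- The clauses `sub(x, f(x₁, …, xₙ)) ← sub(x, xᵢ) ∧ dom(x) ∧ dom(f(x₁, …, xₙ))`. -/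
def App.subArgs (p : App) : List Clause :=
  List.ofFn fun i : Fin p.fn.arity => ⟨[subAtom (.var 0) (genTerm p.fn 1)],
    [subAtom (.var 0) (.var (1 + i)), domAtom (.var 0), domAtom (genTerm p.fn 1)]⟩

/-- The restrictions of the clauses `dom(tᵢ) ← P(s₁, …, sₙ)`. -/
def Atom.domTerms (A : Atom) : List Clause :=
  (A.argList.filter fun t => !t.isVar).map fun t => Clause.restrict ⟨[domAtom t], [A.abstraction]⟩

/-- The clauses `dom(xᵢ) ← P(x₁, …, xₙ)`. -/
def Atom.domArgs (A : Atom) : List Clause :=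
  List.ofFn fun i : Fin A.pred.arity => ⟨[domAtom (.var i)], [genAtom A.pred]⟩

def PredSym.isDom : PredSym → Bool
  | .dom => true
  | _ => false

def Atom.isUnary (A : Atom) : Bool := decide (A.pred.arity = 1) && !A.pred.isDom

/-- The clause `x ≈ x ← ⊤`. -/
def eqRefl : Clause := ⟨[eqAtom (.var 0) (.var 0)], []⟩

def shiftList (L : List Clause) : List Clause :=
  (L.map fun C => C.flatten.shift) ++ L.flatMap fun C =>
    (C.flatten.body.filter fun A => A.isDeep).map fun A => consistency A.pred

def shList (L : List Clause) : List Clause := shiftList (L ++ [eqRefl])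

/-- Here and in the following lists, clauses come once per occurrence of a symbol, so no search for
distinct symbols is needed. -/
def crrList (c : ℕ) (L : List Clause) : List Clause :=
  (domConst c).restrict :: (L.flatMap (fun C => [C.restrict]) ++
    L.flatMap fun C => C.apps.flatMap fun p => [p.domClosure])

def rrList (c : ℕ) (L : List Clause) : List Clause :=
  (domConst c).restrict :: (L.flatMap (fun C => [C.restrict]) ++
    (L.flatMap (fun C => C.body.flatMap Atom.domTerms) ++
      -- Equality counts as a predicate symbol even if it does not occur; only the predicate symbol
      -- of this atom matters.
      ((Atom.domArgs (eqAtom (.var 0) (.var 0))) ++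
        (L.flatMap (fun C => C.atoms.flatMap Atom.domArgs) ++
          L.flatMap fun C => C.apps.flatMap App.domArgs))))

def subList (L : List Clause) : List Clause :=
  ⟨[subAtom (.var 0) (.var 0)], [domAtom (.var 0)]⟩ :: L.flatMap fun C => C.apps.flatMap App.subArgs

/-- The clauses `x ≈ y ∨ x ≉ y ← B ∧ p(x) ∧ p(y)` for the unary predicate symbols `p`. -/
def splitList (B : List Atom) (L : List Clause) : List Clause :=
  L.flatMap fun C => (C.atoms.filter fun A => A.isUnary).flatMap fun A =>
    [eqSplit (B ++ [unaryAtom A.pred (.var 0), unaryAtom A.pred (.var 1)])]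

def Restriction.list : Restriction → ℕ → List Clause → List Clause
  | .new => rrList
  | .classical => crrList

def Blocking.list : Blocking → List Clause → List Clause
  | .subtermDomain => fun L =>
    eqSplit [subAtom (.var 0) (.var 1)] :: consistency .eq :: subList L
  | .subtermPredicate => fun L =>
    consistency .eq :: (subList L ++ splitList [subAtom (.var 0) (.var 1)] L)
  | .unrestrictedDomain => fun _ =>
    [eqSplit [domAtom (.var 0), domAtom (.var 1)], consistency .eq]
  | .unrestrictedPredicate => fun L => consistency .eq :: splitList [] L

def blockList : Option Blocking → List Clause → List Clause
  | none => fun _ => []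
  | some τ => τ.list

/-- The blocking clauses are read off the clauses before restriction, whose size is still linear,
although `tr` defines them from the restricted set. Both give the same clauses by
`subAxioms_restriction` and `unarySyms_restriction`. -/
def trList (shift : Bool) (r : Restriction) (b : Option Blocking) (c : ℕ) (L : List Clause) :
    List Clause :=
  let L' := if shift then shList L else L
  r.list c L' ++ blockList b L'

/-! ## Programs for the transformations -/

theorem clausesSize_append (L N : List Clause) :
    clausesSize (L ++ N) = clausesSize L + clausesSize N := by
  simp [clausesSize]

theorem size_eqAtom (s t : Term) : (eqAtom s t).size = 1 + (s.size + t.size) := by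
  have h : (eqAtom s t).argList = [s, t] := rfl
  simp [Atom.size_eq, h]

theorem size_domAtom (t : Term) : (domAtom t).size = 1 + t.size := by
  have h : (domAtom t).argList = [t] := rfl
  simp [Atom.size_eq, h]

theorem size_genAtom (p : PredSym) : (genAtom p).size = 1 + p.arity := by
  change 1 + ∑ _i : Fin p.arity, 1 = 1 + p.arity
  simp

theorem clausesSize_eqRefl : clausesSize [eqRefl] = 4 := by
  simp [clausesSize, eqRefl, Clause.size, Clause.atoms, size_eqAtom, Term.size]

theorem Atom.size_flat_le (k : ℕ) (A : Atom) : (A.flat k).size ≤ A.size := by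
  rw [Atom.flat]
  split_ifs
  · exact le_rfl
  · refine Nat.add_le_add_left (Finset.sum_le_sum fun i _ => ?_) 1
    dsimp only
    split_ifs
    · exact (A.args i).size_pos
    · exact le_rfl

theorem atomsSize_flatEqs_le (k : ℕ) (A : Atom) : atomsSize (A.flatEqs k) ≤ 3 * A.size := by
  rw [Atom.flatEqs]
  split_ifs
  · simp [atomsSize]
  · rw [atomsSize, List.map_flatten, List.sum_flatten, List.map_ofFn, List.map_ofFn, List.sum_ofFn]
    refine (Finset.sum_le_sum (g := fun i => 3 * (A.args i).size) fun i _ => ?_).trans ?_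
    · have := (A.args i).size_pos
      by_cases h : (A.args i).isProper
      · simp [h, size_eqAtom, Term.size]
        omega
      · simp [h]
    · rw [← Finset.mul_sum, Atom.size]
      omega

theorem atomsSize_flatAtoms_le (k : ℕ) (l : List Atom) :
    atomsSize (flatAtoms k l) ≤ atomsSize l := by
  induction l generalizing k with
  | nil => exact le_rfl
  | cons A l ih =>
    rw [flatAtoms, atomsSize_cons, atomsSize_cons]
    exact Nat.add_le_add (A.size_flat_le k) (ih _)

theorem atomsSize_flatAtomsEqs_le (k : ℕ) (l : List Atom) :
    atomsSize (flatAtomsEqs k l) ≤ 3 * atomsSize l := by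
  induction l generalizing k with
  | nil => exact le_rfl
  | cons A l ih =>
    rw [flatAtomsEqs, atomsSize_append, atomsSize_cons, mul_add]
    exact Nat.add_le_add (atomsSize_flatEqs_le k A) (ih _)

theorem Clause.size_flatten_le (C : Clause) : C.flatten.size ≤ 4 * C.size := by
  have h₁ := atomsSize_flatAtoms_le (freshVar C.vars) C.body
  have h₂ := atomsSize_flatAtomsEqs_le (freshVar C.vars) C.body
  rw [Clause.size_eq, Clause.size_eq, Clause.flatten, atomsSize_append]
  dsimp only
  omega

theorem Clause.size_shift_le (C : Clause) : C.shift.size ≤ C.size := by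
  have h : ∀ l : List Atom, atomsSize ((l.filter fun A => A.isDeep).map Atom.neg) +
      atomsSize (l.filter fun A => !A.isDeep) = atomsSize l := fun l => by
    induction l with
    | nil => rfl
    | cons A l ih =>
      have : A.neg.size = A.size := rfl
      by_cases hA : A.isDeep <;> simp [hA, atomsSize_cons] <;> omega
  have := h C.body
  rw [Clause.size_eq, Clause.size_eq, Clause.shift, atomsSize_append]
  dsimp only
  omega

theorem size_consistency_le (A : Atom) : (consistency A.pred).size ≤ 3 * A.size := by
  have h := A.arity_lt
  have h₁ := size_genAtom A.pred
  have h₂ : (genAtom A.pred).neg.size = 1 + A.pred.arity := h₁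
  simp [Clause.size_eq, consistency, atomsSize, h₁, h₂]
  omega

/-- A linear bound, so that a quadratic computation after shifting stays quadratic in the original
size. Flattening at most quadruples a clause, since an extracted term t yields an equation of size
|t| + 2 ≤ 3|t|; the consistency clauses add at most three times the flattened size. Together this is
the factor 16. -/
theorem clausesSize_shList_le (L : List Clause) :
    clausesSize (shList L) ≤ 100 * (clausesSize L + 1) := by
  have h : ∀ N : List Clause, clausesSize (shiftList N) ≤ 16 * clausesSize N := fun N => by
    induction N with
    | nil => simp [clausesSize, shiftList]
    | cons C N ih =>
      have h₁ := C.size_flatten_le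
      have h₂ := C.flatten.size_shift_le
      have h₃ : clausesSize ((C.flatten.body.filter fun A => A.isDeep).map
          fun A => consistency A.pred) ≤ 3 * C.flatten.size := by
        rw [clausesSize, List.map_map]
        refine (sum_map_le _ fun A _ => size_consistency_le A).trans ?_
        rw [sum_map_mul]
        have := sum_map_filter_le C.flatten.body (fun A => A.isDeep) Atom.size
        rw [Clause.size_eq C.flatten]
        unfold atomsSize
        omega
      simp only [shiftList, clausesSize_append] at ih ⊢
      simp only [List.map_cons, List.flatMap_cons, clausesSize_append]
      simp only [clausesSize, List.map_cons, List.sum_cons] at *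
      omega
  refine (h _).trans ?_
  rw [clausesSize_append, clausesSize_eqRefl]
  omega

namespace InTime

variable {α β γ δ : Type} [Coded α] [Coded β] [Coded γ] [Coded δ] {T T' S : α → ℕ}

theorem isDom {p : α → PredSym} (hp : InTime p T) : InTime (fun a => (p a).isDom) T :=
  (dataNatEq (dataFst (f := fun a => code (p a)) hp) (const (.nat 2))).retype fun a => by
    cases p a <;> rfl

theorem isUnary : InTime Atom.isUnary Atom.size :=
  and ((natEq (addArity.comp' (pair (const 0) id) fun _ => le_rfl) (const 1)).congr fun A => by
    simp) (not (isDom (pred id)))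

theorem unaryAtom (x : ℕ) : InTime (fun A : Atom => BUMG.unaryAtom A.pred (.var x)) Atom.size :=
  atom (pred id) ((map (argList id) (T := fun _ => 0) (g := fun _ _ => Term.var x)
    (S := fun _ _ => 0) (const _)).mono 1 fun A => by
      have := A.length_argList_lt
      simp
      omega) (fun _ => rfl) fun A => by
    rw [Atom.argList, Atom.argList, List.map_ofFn]
    rfl

theorem appVars (k : ℕ) :
    InTime (fun p : App => BUMG.mapFrom (fun k _ => Term.var k) k p.argList)
      fun p => p.fn.arity + 1 :=
  (mapFrom (appArgList id) (const k) (T := fun _ => 0) (g := fun _ k _ => Term.var k)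
    (S := fun _ _ => 0) (var (fst (snd id)))).mono 1 fun p => by
      simp [p.length_argList]
      omega

theorem genTerm (k : ℕ) : InTime (fun p : App => BUMG.genTerm p.fn k) fun p => p.fn.arity + 1 :=
  (pair (const 1) (pair (appFn id) (appVars k))).retype fun p => by
    have h : BUMG.mapFrom (fun k _ => Term.var k) k p.argList =
      List.ofFn fun i : Fin p.fn.arity => Term.var (k + i) := mapFrom_ofFn _ _ _
    rw [h]
    simp [code, BUMG.genTerm, Term.enc, List.map_ofFn, Function.comp_def]

theorem domClosure : InTime App.domClosure fun p => p.fn.arity + 1 :=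
  clause (cons (domAtom (genTerm 0)) nil) (((map (appVars 0) (g := fun _ t => BUMG.domAtom t)
    (S := fun _ _ => 0) (domAtom (snd id))).mono 2 fun p => by
      rw [App.argList, mapFrom_ofFn]
      simp only [List.map_const', List.length_ofFn, List.sum_replicate, smul_eq_mul]
      omega).congr fun p => by
    rw [App.argList, mapFrom_ofFn, List.map_ofFn]
    simp [Function.comp_def])

/-- The value `f p`, typically f(x₁, …, xₙ), is computed once and shared by the n clauses, which
makes the time linear in the arity although the clauses written out have quadratic size.
`atomDomArgs` shares its body atom likewise. -/
theorem appMapFrom (k : ℕ) {B : Type} [Coded B] {f : App → B} {g : B → ℕ → Clause}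
    (hf : InTime f fun p => p.fn.arity + 1)
    (hg : InTime (fun q : B × ℕ => g q.1 q.2) fun _ => 0) :
    InTime (fun p : App => List.ofFn fun i : Fin p.fn.arity => g (f p) (k + i))
      fun p => p.fn.arity + 1 := by
  have h : InTime (fun q : B × List Term => BUMG.mapFrom (fun k _ => g q.1 k) k q.2)
      fun q => q.2.length :=
    (mapFrom (snd id) (const k) (T := fun _ => 0) (g := fun q k _ => g q.1 k) (S := fun _ _ => 0)
      (hg.comp' (pair (fst (fst id)) (fst (snd id))) fun _ => le_rfl)).mono' (by simp)
  refine (h.comp' (pair hf (appArgList id)) fun p => ?_).congr fun p => ?_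
  · simp [p.length_argList]
  · rw [App.argList, mapFrom_ofFn]

theorem appDomArgs : InTime App.domArgs fun p => p.fn.arity + 1 :=
  (appMapFrom 0 (genTerm 0) (g := fun t k => ⟨[BUMG.domAtom (.var k)], [BUMG.domAtom t]⟩)
    (clause (cons (domAtom (var (snd id))) nil) (cons (domAtom (fst id)) nil))).congr fun p => by
      simp [App.domArgs]

theorem subArgs : InTime App.subArgs fun p => p.fn.arity + 1 :=
  appMapFrom 1 (genTerm 1) (g := fun t k => ⟨[BUMG.subAtom (.var 0) t],
      [BUMG.subAtom (.var 0) (.var k), BUMG.domAtom (.var 0), BUMG.domAtom t]⟩)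
    (clause (cons (subAtom (const _) (fst id)) nil) (cons (subAtom (const _) (var (snd id)))
      (cons (domAtom (const _)) (cons (domAtom (fst id)) nil))))

theorem atomDomArgs : InTime Atom.domArgs Atom.size := by
  have h : InTime (fun q : Atom × List Term => BUMG.mapFrom
      (fun k _ => (⟨[BUMG.domAtom (.var k)], [q.1]⟩ : Clause)) 0 q.2) fun q => q.2.length :=
    (mapFrom (snd id) (const 0) (T := fun _ => 0) (S := fun _ _ => 0)
      (g := fun q k _ => (⟨[BUMG.domAtom (.var k)], [q.1]⟩ : Clause))
      (clause (cons (domAtom (var (fst (snd id)))) nil) (cons (fst (fst id)) nil))).mono' (by simp)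
  refine (h.comp' (pair genAtom (argList id)) fun A => A.length_argList_lt.le).congr fun A => ?_
  rw [Atom.argList, mapFrom_ofFn]
  simp [Atom.domArgs]

theorem abstraction : InTime Atom.abstraction Atom.size := by
  have h : InTime (fun q : ℕ × List Term => BUMG.mapFrom
      (fun k (t : Term) => if t.isVar then t else .var k) q.1 q.2) fun q => q.2.length :=
    (mapFrom (snd id) (fst id) (T := fun _ => 0) (S := fun _ _ => 0)
      (g := fun _ k (t : Term) => if t.isVar then t else .var k)
      (cond (isVar (snd (snd id))) (snd (snd id)) (var (fst (snd id))))).mono'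
        (T' := fun q => q.2.length) (by simp)
  have h' : InTime (fun A : Atom => BUMG.freshVar A.vars) Atom.size :=
    (freshVar vars).mono 2 fun A => by have := A.length_vars_le; omega
  refine atom (pred id) (h.comp' (pair h' (argList id)) fun A => A.length_argList_lt.le)
    (fun _ => rfl) fun A => ?_
  rw [Atom.argList, Atom.argList, mapFrom_ofFn]
  rfl

theorem size_abstraction_le (A : Atom) : A.abstraction.size ≤ A.size := by
  refine Nat.add_le_add_left (Finset.sum_le_sum fun i _ => ?_) 1
  change (if (A.args i).isVar then A.args i else .var (BUMG.freshVar A.vars + i)).size ≤ _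
  split_ifs
  · exact le_rfl
  · exact (A.args i).size_pos

/-- The clause for the argument t costs about |t| · |A|, by the form of the bound on `restrict`, and
the sizes of the arguments of A sum to less than |A|. -/
theorem domTerms : InTime Atom.domTerms fun A => A.size ^ 2 := by
  have h₁ : InTime (fun A : Atom => A.argList.filter fun t => !t.isVar) Atom.size :=
    (filter (argList id) (T := fun _ => 0) (S := fun _ _ => 0) (g := fun _ t => !t.isVar)
      (not (isVar (snd id)))).mono' fun A => by
        have := A.length_argList_lt
        simp
        omega
  have h₂ : InTime (fun q : Atom × Term =>
      Clause.restrict ⟨[BUMG.domAtom q.2], [q.1.abstraction]⟩)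
      fun q => (q.2.size + 2) * (q.2.size + q.1.size + 2) := by
    refine restrict.comp' (clause (cons (domAtom (snd id)) nil)
      (cons ((abstraction.comp (fst id) 1 fun q => ?_)) nil)) fun q => ?_
    · nlinarith
    · have h := size_abstraction_le q.1
      have h' : (BUMG.domAtom q.2).size = 1 + q.2.size := size_domAtom _
      rw [Clause.size_eq]
      simp only [atomsSize, List.map_cons, List.map_nil, List.sum_cons, List.sum_nil, h']
      exact Nat.mul_le_mul (by omega) (by omega)
  refine (map h₁ (g := fun A t => Clause.restrict ⟨[BUMG.domAtom t], [A.abstraction]⟩)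
    (S := fun A t => (t.size + 2) * (t.size + A.size + 2)) h₂).mono 20 fun A => ?_
  have h₃ : ((A.argList.filter fun t => !t.isVar).map
      fun t => (t.size + 2) * (t.size + A.size + 2) + 1).sum ≤ 12 * A.size * A.size := by
    refine (sum_map_filter_le _ _ _).trans ((sum_map_le A.argList
      (g := fun t => (12 * A.size) * t.size) fun t ht => ?_).trans ?_)
    · have h₁ := t.size_pos
      have h₂ := le_sum_of_mem ht Term.size
      have h₃ := A.size_eq
      nlinarith [Nat.mul_le_mul h₁ (le_refl A.size)]
    · rw [sum_map_mul]
      exact Nat.mul_le_mul_left _ (by rw [A.size_eq]; omega)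
  have h₄ := A.size_pos
  nlinarith

/-! ### Collecting the clauses generated by the occurrences of symbols -/

theorem flatMapApps {g : App → List Clause} (hg : InTime g fun p => p.fn.arity + 1)
    (hlen : ∀ p, (g p).length ≤ p.fn.arity + 1) :
    InTime (fun C : Clause => C.apps.flatMap g) Clause.size := by
  refine (flatMap clauseApps (g := fun _ p => g p) (S := fun _ p => p.fn.arity + 1)
    (hg.comp' (snd id) fun _ => le_rfl)).mono 7 fun C => ?_
  have h := sum_map_le C.apps (f := fun p => p.fn.arity + 1 + (g p).length + 1)
    (g := fun p => 3 * (p.fn.arity + 1)) fun p _ => by have := hlen p; omega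
  rw [sum_map_mul] at h
  have := C.apps_size_le
  omega

theorem length_flatMapApps_le {g : App → List Clause} (hlen : ∀ p, (g p).length ≤ p.fn.arity + 1)
    (C : Clause) : (C.apps.flatMap g).length ≤ 2 * C.size := by
  rw [length_flatMap_eq]
  exact (sum_map_le _ fun p _ => hlen p).trans C.apps_size_le

/-- Quadratic cost per atom becomes quadratic cost per clause, as sums of squares are bounded by
squares of sums. The length of the generated lists is bounded separately because concatenation walks
through them. `flatMapClauses` repeats the argument from clauses to clause lists. -/
theorem flatMapAtoms {s : Clause → List Atom} {g : Atom → List Clause} (hs : InTime s Clause.size)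
    (hsize : ∀ C, atomsSize (s C) ≤ C.size) (hg : InTime g fun A => A.size ^ 2)
    (hlen : ∀ A, (g A).length ≤ A.size) :
    InTime (fun C : Clause => (s C).flatMap g) fun C => C.size ^ 2 := by
  refine (flatMap hs (g := fun _ A => g A) (S := fun _ A => A.size ^ 2)
    (hg.comp' (snd id) fun _ => le_rfl)).mono 4 fun C => ?_
  have h := sum_map_le (s C) (f := fun A => A.size ^ 2 + (g A).length + 1)
    (g := fun A => 3 * A.size ^ 2) fun A _ => by
      have := hlen A
      have := A.size_pos
      nlinarith
  rw [sum_map_mul] at h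
  have h₁ := sum_sq_le (s C) Atom.size
  have h₂ := Nat.pow_le_pow_left (hsize C) 2
  have h₃ := C.size_pos
  rw [atomsSize] at h₂
  nlinarith

theorem length_flatMapAtoms_le {s : Clause → List Atom} {g : Atom → List Clause}
    (hsize : ∀ C, atomsSize (s C) ≤ C.size) (hlen : ∀ A, (g A).length ≤ A.size) (C : Clause) :
    ((s C).flatMap g).length ≤ 2 * C.size := by
  rw [length_flatMap_eq]
  refine (sum_map_le _ fun A _ => hlen A).trans ?_
  have := hsize C
  rw [atomsSize] at this
  omega

theorem flatMapClauses {g : Clause → List Clause} (hg : InTime g fun C => C.size ^ 2)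
    (hlen : ∀ C, (g C).length ≤ 2 * C.size) :
    InTime (fun L : List Clause => L.flatMap g) fun L => clausesSize L ^ 2 := by
  refine (flatMap id (T := fun _ => 0) (g := fun _ C => g C) (S := fun _ C => C.size ^ 2)
    (hg.comp' (snd id) fun _ => le_rfl)).mono 4 fun L => ?_
  have h := sum_map_le L (f := fun C => C.size ^ 2 + (g C).length + 1)
    (g := fun C => 4 * C.size ^ 2) fun C _ => by
      have := hlen C
      have := C.size_pos
      nlinarith
  rw [sum_map_mul] at h
  have h₁ := sum_sq_le L Clause.size
  rw [clausesSize]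
  omega

theorem length_flatMapClauses_le {g : Clause → List Clause}
    (hlen : ∀ C, (g C).length ≤ 2 * C.size) (L : List Clause) :
    (L.flatMap g).length ≤ 2 * clausesSize L := by
  rw [length_flatMap_eq, clausesSize, ← sum_map_mul]
  exact sum_map_le _ fun _ _ => hlen _

theorem sq {f : Clause → β} (hf : InTime f Clause.size) : InTime f fun C => C.size ^ 2 :=
  hf.mono' fun _ => Nat.le_self_pow two_ne_zero _

theorem appendClauses {l m : List Clause → List Clause}
    (hl : InTime l fun L => clausesSize L ^ 2) (hm : InTime m fun L => clausesSize L ^ 2)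
    (hlen : ∀ L, (l L).length ≤ 2 * clausesSize L) :
    InTime (fun L => l L ++ m L) fun L => clausesSize L ^ 2 :=
  (append hl hm).mono 4 fun L => by
    have := hlen L
    nlinarith [sq_nonneg ((clausesSize L : ℤ) - 1)]

theorem atomsSize_body_le (C : Clause) : atomsSize C.body ≤ C.size := by
  rw [C.size_eq]
  omega

theorem atomsSize_atoms_le (C : Clause) : atomsSize C.atoms ≤ C.size := by
  rw [Clause.size, atomsSize]
  omega

theorem flatMapRestrict : InTime (fun L : List Clause => L.flatMap fun C => [C.restrict])
    fun L => clausesSize L ^ 2 :=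
  flatMapClauses (cons (restrict.mono' fun C => by
    rw [_root_.sq]
    exact Nat.mul_le_mul_right _ (by rw [C.size_eq]; omega)) nil) fun C => by
      have := C.size_pos
      simp
      omega

theorem length_flatMapRestrict_le (L : List Clause) :
    (L.flatMap fun C => [C.restrict]).length ≤ 2 * clausesSize L :=
  length_flatMapClauses_le (fun C => by have := C.size_pos; simp; omega) L

theorem restrictDomConst {T : ℕ → ℕ} : InTime (fun c => (domConst c).restrict) T := by
  have h : ∀ c, (domConst c).restrict = domConst c := fun c => by
    simp [Clause.restrict, Clause.headOnlyVars, domConst, BUMG.atomsVars, BUMG.domAtom, Atom.vars,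
      constTerm, Term.vars, PredSym.arity]
  refine (clause (cons (domAtom (t := constTerm) ?_) nil) nil).congr h
  exact (pair (const 1) (pair (pair id (const 0)) (nil (β := Term)))).retype fun c => rfl

theorem crrList : InTime (fun q : ℕ × List Clause => BUMG.crrList q.1 q.2)
    fun q => clausesSize q.2 ^ 2 := by
  have h : InTime (fun L : List Clause => L.flatMap (fun C => [C.restrict]) ++
      L.flatMap fun C => C.apps.flatMap fun p => [p.domClosure]) fun L => clausesSize L ^ 2 :=
    appendClauses flatMapRestrict (flatMapClauses (sq (flatMapApps (cons domClosure nil)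
      (by simp))) (length_flatMapApps_le (by simp))) length_flatMapRestrict_le
  exact cons (restrictDomConst.comp' (T := fun q : ℕ × List Clause => clausesSize q.2 ^ 2)
    (R := fun _ => 0) (fst id) fun _ => Nat.zero_le _)
    (h.comp' (snd id) fun _ => le_rfl)

theorem length_domTerms_le (A : Atom) : A.domTerms.length ≤ A.size := by
  rw [Atom.domTerms, List.length_map]
  exact (List.length_filter_le _ _).trans A.length_argList_lt.le

theorem length_atomDomArgs_le (A : Atom) : A.domArgs.length ≤ A.size := by
  rw [Atom.domArgs, List.length_ofFn]
  exact A.arity_lt.le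

theorem rrList : InTime (fun q : ℕ × List Clause => BUMG.rrList q.1 q.2)
    fun q => clausesSize q.2 ^ 2 := by
  have h₁ : InTime (fun L : List Clause => L.flatMap fun C => C.body.flatMap Atom.domTerms)
      fun L => clausesSize L ^ 2 :=
    flatMapClauses (flatMapAtoms (body id) atomsSize_body_le domTerms length_domTerms_le)
      (length_flatMapAtoms_le atomsSize_body_le length_domTerms_le)
  have h₂ : InTime (fun L : List Clause => L.flatMap fun C => C.atoms.flatMap Atom.domArgs)
      fun L => clausesSize L ^ 2 :=
    flatMapClauses (flatMapAtoms atoms atomsSize_atoms_le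
      (atomDomArgs.mono' fun A => Nat.le_self_pow two_ne_zero _) length_atomDomArgs_le)
      (length_flatMapAtoms_le atomsSize_atoms_le length_atomDomArgs_le)
  have h₃ : InTime (fun L : List Clause => L.flatMap fun C => C.apps.flatMap App.domArgs)
      fun L => clausesSize L ^ 2 :=
    flatMapClauses (sq (flatMapApps appDomArgs (by simp [App.domArgs])))
      (length_flatMapApps_le (by simp [App.domArgs]))
  have h₄ : InTime (fun L : List Clause => Atom.domArgs (BUMG.eqAtom (.var 0) (.var 0)) ++
      (L.flatMap (fun C => C.atoms.flatMap Atom.domArgs) ++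
        L.flatMap fun C => C.apps.flatMap App.domArgs)) fun L => clausesSize L ^ 2 :=
    (append (const _) (appendClauses h₂ h₃ (length_flatMapClauses_le
      (length_flatMapAtoms_le atomsSize_atoms_le length_atomDomArgs_le)))).mono 2 fun L => by
        simp [Atom.domArgs, BUMG.eqAtom, PredSym.arity]
        omega
  have h := appendClauses flatMapRestrict (appendClauses h₁ h₄ (length_flatMapClauses_le
    (length_flatMapAtoms_le atomsSize_body_le length_domTerms_le))) length_flatMapRestrict_le
  exact cons (restrictDomConst.comp' (T := fun q : ℕ × List Clause => clausesSize q.2 ^ 2)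
    (R := fun _ => 0) (fst id) fun _ => Nat.zero_le _)
    (h.comp' (snd id) fun _ => le_rfl)

theorem subList : InTime BUMG.subList fun L => clausesSize L ^ 2 :=
  cons (const _) (flatMapClauses (sq (flatMapApps subArgs (by simp [App.subArgs])))
    (length_flatMapApps_le (by simp [App.subArgs])))

theorem atomsSize_filter_le (p : Atom → Bool) (C : Clause) :
    atomsSize (C.atoms.filter p) ≤ C.size :=
  (sum_map_filter_le _ _ _).trans (atomsSize_atoms_le C)

theorem splitList (B : List Atom) : InTime (BUMG.splitList B) fun L => clausesSize L ^ 2 := by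
  have h₁ : InTime (fun C : Clause => C.atoms.filter fun A => A.isUnary) Clause.size := by
    refine (filter atoms (S := fun _ A => A.size) (g := fun _ A => A.isUnary)
      (isUnary.comp' (snd id) fun _ => le_rfl)).mono 3 fun C => ?_
    have h₁ := length_le_atomsSize C.atoms
    have h₂ := atomsSize_atoms_le C
    rw [sum_map_add, ← atomsSize]
    simp
    omega
  have h₂ : InTime (fun A : Atom => [eqSplit (B ++ [BUMG.unaryAtom A.pred (.var 0),
      BUMG.unaryAtom A.pred (.var 1)])]) fun A => A.size ^ 2 := by
    refine cons (clause (const _) ?_) nil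
    refine (append (const B) (cons (unaryAtom 0) (cons (unaryAtom 1) nil))).mono (B.length + 1)
      fun A => ?_
    nlinarith [A.size_pos, Nat.zero_le (B.length * A.size ^ 2)]
  have h₃ : ∀ A : Atom, [eqSplit (B ++ [BUMG.unaryAtom A.pred (.var 0),
      BUMG.unaryAtom A.pred (.var 1)])].length ≤ A.size := fun A => A.size_pos
  exact flatMapClauses (flatMapAtoms h₁ (atomsSize_filter_le _) h₂ h₃)
    (length_flatMapAtoms_le (atomsSize_filter_le _) h₃)

theorem length_subList_le (L : List Clause) :
    (BUMG.subList L).length ≤ 2 * clausesSize L + 1 := by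
  rw [BUMG.subList, List.length_cons]
  exact Nat.succ_le_succ
    (length_flatMapClauses_le (length_flatMapApps_le (by simp [App.subArgs])) L)

theorem blockList (b : Option Blocking) : InTime (BUMG.blockList b) fun L => clausesSize L ^ 2 := by
  match b with
  | none => exact const []
  | some .subtermDomain => exact cons (const _) (cons (const _) subList)
  | some .subtermPredicate =>
    refine cons (const _) ((append subList (splitList _)).mono 5 fun L => ?_)
    have := length_subList_le L
    nlinarith [sq_nonneg ((clausesSize L : ℤ) - 1)]
  | some .unrestrictedDomain => exact const _
  | some .unrestrictedPredicate => exact cons (const _) (splitList _)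

theorem restrictionList (r : Restriction) :
    InTime (fun q : ℕ × List Clause => r.list q.1 q.2) fun q => clausesSize q.2 ^ 2 := by
  cases r
  · exact rrList
  · exact crrList

/-- Appending the blocking clauses traverses the restricted list, so its number of clauses, though
not their total size, has to be small. -/
theorem length_restrictionList_le (r : Restriction) (c : ℕ) (L : List Clause) :
    (r.list c L).length ≤ 8 * clausesSize L + 3 := by
  have h₁ := length_flatMapRestrict_le L
  cases r
  · have h₂ := length_flatMapClauses_le
      (length_flatMapAtoms_le atomsSize_body_le length_domTerms_le) L
    have h₃ := length_flatMapClauses_le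
      (length_flatMapAtoms_le atomsSize_atoms_le length_atomDomArgs_le) L
    have h₄ := length_flatMapClauses_le
      (length_flatMapApps_le (g := App.domArgs) (by simp [App.domArgs])) L
    have h₅ : (Atom.domArgs (BUMG.eqAtom (.var 0) (.var 0))).length = 2 := by
      rw [Atom.domArgs, List.length_ofFn]
      rfl
    rw [Restriction.list, BUMG.rrList, List.length_cons]
    simp only [List.length_append, h₅]
    omega
  · have h₂ := length_flatMapClauses_le
      (length_flatMapApps_le (g := fun p => [p.domClosure]) (by simp)) L
    rw [Restriction.list, BUMG.crrList, List.length_cons]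
    simp only [List.length_append]
    omega

theorem shList : InTime BUMG.shList clausesSize := by
  have hL : InTime (fun L : List Clause => L ++ [eqRefl])
      clausesSize := (append id (const _) (T := fun _ => 0)).mono' fun L => by
    have := length_le_sum L Clause.size_pos
    rw [clausesSize]
    simpa using this
  have h₁ : InTime (fun N : List Clause => N.map fun C => C.flatten.shift) clausesSize := by
    refine (map id (T := fun _ => 0) (g := fun _ (C : Clause) => C.flatten.shift)
      (S := fun _ C => C.size)
      ((shift.comp flattenClause 4 fun C => ?_).comp' (snd id) fun _ => le_rfl)).mono 2 fun N => ?_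
    · have := C.size_flatten_le
      omega
    · have := length_le_sum N Clause.size_pos
      rw [sum_map_add, clausesSize]
      simp
      omega
  have h₂ : InTime (fun C : Clause => (C.body.filter fun A => A.isDeep).map
      fun A => BUMG.consistency A.pred) Clause.size := by
    have h : InTime (fun C : Clause => C.body.filter fun A => A.isDeep) Clause.size := by
      refine (filter (body id) (T := fun _ => 0) (S := fun _ A => A.size)
        (g := fun _ A => A.isDeep) (isDeep.comp' (snd id) fun _ => le_rfl)).mono 2 fun C => ?_
      have h₁ := length_le_atomsSize C.body
      have h₂ := C.size_eq
      rw [sum_map_add, ← atomsSize]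
      simp
      omega
    refine (map h (g := fun _ A => BUMG.consistency A.pred) (S := fun _ A => A.size)
      (consistency.comp' (snd id) fun _ => le_rfl)).mono 3 fun C => ?_
    have h₁ := length_le_atomsSize (C.body.filter fun A => A.isDeep)
    have h₂ := C.size_eq
    have h₃ : atomsSize (C.body.filter fun A => A.isDeep) ≤ atomsSize C.body :=
      sum_map_filter_le _ _ _
    rw [sum_map_add, ← atomsSize]
    simp at h₁ ⊢
    omega
  have h₃ : InTime (fun N : List Clause => N.flatMap fun C =>
      (C.flatten.body.filter fun A => A.isDeep).map fun A => BUMG.consistency A.pred)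
      clausesSize := by
    have h : InTime (fun C : Clause => (C.flatten.body.filter fun A => A.isDeep).map
        fun A => BUMG.consistency A.pred) Clause.size :=
      h₂.comp flattenClause 4 fun C => by have := C.size_flatten_le; omega
    refine (flatMap id (T := fun _ => 0) (g := fun _ (C : Clause) =>
      (C.flatten.body.filter fun A => A.isDeep).map fun A => BUMG.consistency A.pred)
      (S := fun _ C => C.size) (h.comp' (snd id) fun _ => le_rfl)).mono 6 fun N => ?_
    have h := sum_map_le N (f := fun C : Clause => C.size + ((C.flatten.body.filter
      fun A => A.isDeep).map fun A => BUMG.consistency A.pred).length + 1)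
      (g := fun C => 6 * C.size) fun C _ => by
        have h₁ := length_le_atomsSize C.flatten.body
        have h₂ := C.flatten.size_eq
        have h₃ := List.length_filter_le (fun A : Atom => A.isDeep) C.flatten.body
        have h₄ := C.size_flatten_le
        have h₅ := C.size_pos
        rw [List.length_map]
        omega
    rw [sum_map_mul] at h
    rw [clausesSize]
    omega
  have h₄ : InTime BUMG.shiftList clausesSize :=
    (append h₁ h₃).mono 2 fun N => by
      have := length_le_sum N Clause.size_pos
      rw [List.length_map, clausesSize]
      omega
  refine h₄.comp hL 5 fun L => ?_
  rw [clausesSize_append, clausesSize_eqRefl]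
  omega

theorem trList (sh : Bool) (r : Restriction) (b : Option Blocking) :
    InTime (fun q : ℕ × List Clause => BUMG.trList sh r b q.1 q.2)
      fun q => clausesSize q.2 ^ 2 := by
  have h : InTime (fun q : ℕ × List Clause => r.list q.1 q.2 ++ BUMG.blockList b q.2)
      fun q => clausesSize q.2 ^ 2 := by
    refine (append (restrictionList r) ((blockList b).comp' (snd id) fun _ => le_rfl)).mono 10
      fun q => ?_
    have := length_restrictionList_le r q.1 q.2
    nlinarith [sq_nonneg ((clausesSize q.2 : ℤ) - 1)]
  cases sh
  · exact h
  · have hs : InTime (fun q : ℕ × List Clause => BUMG.shList q.2) fun q => clausesSize q.2 ^ 2 :=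
      shList.comp' (snd id) fun q => Nat.le_self_pow two_ne_zero _
    -- With n the original size, (100(n + 1))² = 10000(n + 1)², and (n + 1)² ≤ 2(n² + 1).
    refine h.comp (pair (fst id) hs) 40000 fun q => ?_
    have := Nat.pow_le_pow_left (clausesSize_shList_le q.2) 2
    dsimp only
    nlinarith [sq_nonneg ((clausesSize q.2 : ℤ) - 1)]

end InTime

theorem quadraticTime_of_inTime {F : ℕ → Set Clause → Set Clause} {f : ℕ → List Clause → List Clause}
    (hf : InTime (fun q : ℕ × List Clause => f q.1 q.2) fun q => clausesSize q.2 ^ 2)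
    (hF : ∀ c L, {C | C ∈ f c L} = F c {C | C ∈ L}) : QuadraticTime F := by
  -- Offset 1, since index 0 is reserved for the entry point `e`.
  obtain ⟨e, aux, K, h⟩ := hf 1
  refine ⟨e :: aux, K + 2, fun c L _ => ?_⟩
  have hP : Located 0 (e :: aux) (e :: aux) := fun j b hb => by rwa [Nat.zero_add]
  obtain ⟨t, ht, hev⟩ := EvalLe.arg.call hP.head (h (e :: aux) hP.tail (c, L))
  refine ⟨f c L, t, hev, hF c L, ht.trans ?_⟩
  dsimp only
  nlinarith

/-! ## The lists of clauses are those of the transformations -/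

theorem Atom.mem_funs {A : Atom} {f : FunSym} : f ∈ A.funs ↔ ∃ p ∈ A.apps, p.fn = f := by
  rw [Atom.funs_eq, List.mem_map]

theorem mem_funSyms {M : Set Clause} {f : FunSym} :
    f ∈ funSyms M ↔ ∃ C ∈ M, ∃ p ∈ C.apps, p.fn = f := by
  simp only [funSyms, Set.mem_ofPred_eq, Clause.apps, List.mem_flatMap, Atom.mem_funs]
  constructor
  · rintro ⟨C, hC, A, hA, p, hp, h⟩
    exact ⟨C, hC, p, ⟨A, hA, hp⟩, h⟩
  · rintro ⟨C, hC, p, ⟨A, hA, hp⟩, h⟩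
    exact ⟨C, hC, A, hA, p, hp, h⟩

theorem exists_funSyms {L : List Clause} {q : FunSym → Prop} :
    (∃ f ∈ funSyms {C | C ∈ L}, q f) ↔ ∃ C ∈ L, ∃ p ∈ C.apps, q p.fn := by
  simp only [mem_funSyms, Set.mem_ofPred_eq]
  constructor
  · rintro ⟨_, ⟨C, hC, p, hp, rfl⟩, h⟩
    exact ⟨C, hC, p, hp, h⟩
  · rintro ⟨C, hC, p, hp, h⟩
    exact ⟨_, ⟨C, hC, p, hp, rfl⟩, h⟩

theorem exists_predSyms {L : List Clause} {q : PredSym → Prop} :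
    (∃ p ∈ predSyms {C | C ∈ L}, q p) ↔ q .eq ∨ ∃ C ∈ L, ∃ A ∈ C.atoms, q A.pred := by
  simp only [predSyms, Set.mem_ofPred_eq]
  constructor
  · rintro ⟨_, rfl | ⟨C, hC, A, hA, rfl⟩, h⟩
    · exact .inl h
    · exact .inr ⟨C, hC, A, hA, h⟩
  · rintro (h | ⟨C, hC, A, hA, h⟩)
    · exact ⟨_, .inl rfl, h⟩
    · exact ⟨_, .inr ⟨C, hC, A, hA, rfl⟩, h⟩

theorem setOf_shList (L : List Clause) : {C | C ∈ shList L} = sh {C | C ∈ L} := by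
  ext D
  simp only [shList, shiftList, sh, bs, pf, eqRefl, Set.mem_ofPred_eq, Set.mem_union, Set.mem_image,
    List.mem_append, List.mem_map, List.mem_flatMap, List.mem_filter, Set.mem_singleton_iff,
    List.mem_singleton, exists_exists_and_eq_and]
  simp only [and_assoc, eq_comm]

theorem setOf_crrList (c : ℕ) (L : List Clause) :
    {C | C ∈ crrList c L} = crr c {C | C ∈ L} := by
  ext D
  simp only [crr, Set.mem_ofPred_eq, Set.mem_union, Set.mem_image, exists_funSyms, crrList,
    List.mem_append, List.mem_cons, List.mem_flatMap, Set.mem_singleton_iff, List.not_mem_nil,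
    or_false, App.domClosure, or_and_right, exists_or, exists_eq_left, ← or_assoc]
  simp only [eq_comm, or_comm]

theorem Atom.mem_domTerms {A : Atom} {D : Clause} :
    D ∈ A.domTerms ↔ ∃ i, (A.args i).isVar = false ∧
      Clause.restrict ⟨[domAtom (A.args i)], [A.abstraction]⟩ = D := by
  simp [Atom.domTerms, Atom.argList, List.mem_ofFn, and_assoc]

theorem setOf_rrList (c : ℕ) (L : List Clause) :
    {C | C ∈ rrList c L} = rr c {C | C ∈ L} := by
  have h : ∀ D, D ∈ Clause.restrict '' bodyDom {C | C ∈ L} ↔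
      ∃ C ∈ L, ∃ A ∈ C.body, D ∈ A.domTerms := fun D => by
    simp only [bodyDom, Set.mem_image, Set.mem_ofPred_eq, Atom.mem_domTerms]
    constructor
    · rintro ⟨_, ⟨C, hC, A, hA, i, hi, rfl⟩, h⟩
      exact ⟨C, hC, A, hA, i, hi, h⟩
    · rintro ⟨C, hC, A, hA, i, hi, h⟩
      exact ⟨_, ⟨C, hC, A, hA, i, hi, rfl⟩, h⟩
  ext D
  rw [rr, Set.image_union, Set.image_union, Set.image_singleton]
  simp only [Set.mem_ofPred_eq, Set.mem_union, h, predDom, funDom, exists_funSyms, exists_predSyms,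
    rrList, List.mem_append, List.mem_cons, List.mem_flatMap, Set.mem_singleton_iff,
    List.not_mem_nil, or_false, Atom.domArgs, App.domArgs, List.mem_ofFn, Set.mem_image]
  simp only [eq_comm (a := D), or_assoc]
  exact or_left_comm

theorem mem_subAxioms {M : Set Clause} {D : Clause} : D ∈ subAxioms M ↔
    D = ⟨[subAtom (.var 0) (.var 0)], [domAtom (.var 0)]⟩ ∨ ∃ f ∈ funSyms M, ∃ i : Fin f.arity,
      D = ⟨[subAtom (.var 0) (genTerm f 1)],
        [subAtom (.var 0) (.var (1 + i)), domAtom (.var 0), domAtom (genTerm f 1)]⟩ := Iff.rfl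

theorem setOf_subList (L : List Clause) : {C | C ∈ subList L} = subAxioms {C | C ∈ L} := by
  ext D
  simp only [mem_subAxioms, exists_funSyms, subList, Set.mem_ofPred_eq, List.mem_cons,
    List.mem_flatMap, App.subArgs, List.mem_ofFn]
  simp only [eq_comm (a := D)]

theorem Atom.isUnary_eq_true {A : Atom} :
    A.isUnary = true ↔ A.pred.arity = 1 ∧ A.pred ≠ .dom := by
  rw [Atom.isUnary, Bool.and_eq_true, decide_eq_true_iff]
  refine and_congr_right fun _ => ?_
  cases A.pred <;> simp [PredSym.isDom]

/-- Equality, always a predicate symbol, drops out because it is binary. -/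
theorem exists_unarySyms {L : List Clause} {q : PredSym → Prop} :
    (∃ p ∈ unarySyms {C | C ∈ L}, q p) ↔ ∃ C ∈ L, ∃ A ∈ C.atoms, A.isUnary = true ∧ q A.pred := by
  have h := exists_predSyms (L := L) (q := fun p => (p.arity = 1 ∧ p ≠ PredSym.dom) ∧ q p)
  simp only [unarySyms, Set.mem_ofPred_eq, and_assoc, Atom.isUnary_eq_true] at h ⊢
  rw [h]
  simp [PredSym.arity]

theorem mem_splitList {B : List Atom} {L : List Clause} {D : Clause} :
    D ∈ splitList B L ↔ ∃ p ∈ unarySyms {C | C ∈ L},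
      D = eqSplit (B ++ [unaryAtom p (.var 0), unaryAtom p (.var 1)]) := by
  rw [exists_unarySyms]
  simp [splitList, and_assoc]

/-! ### The symbols of the range-restricted clause sets -/

theorem domAtom_funs (t : Term) : (domAtom t).funs = t.funs := by
  simp [domAtom, Atom.funs, PredSym.arity]

theorem domVar_funs (x : ℕ) : (domAtom (.var x)).funs = [] := by
  rw [domAtom_funs, Term.funs]

theorem domConst_funs (c : ℕ) : (domAtom (constTerm c)).funs = [⟨c, 0⟩] := by
  simp [domAtom_funs, constTerm, Term.funs]

theorem funs_of_forall_isVar {A : Atom} (h : ∀ i, (A.args i).isVar = true) : A.funs = [] := by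
  rw [Atom.funs, List.flatten_eq_nil_iff]
  refine forall_mem_ofFn (p := (· = [])).2 fun i => ?_
  have := h i
  cases hi : A.args i with
  | var x => rfl
  | app f args => simp [hi, Term.isVar] at this

theorem genTerm_funs (f : FunSym) (k : ℕ) : (genTerm f k).funs = [f] := by
  simp [genTerm, Term.funs]

theorem abstraction_funs (A : Atom) : A.abstraction.funs = [] := by
  refine funs_of_forall_isVar fun i => ?_
  change (if (A.args i).isVar then A.args i else .var (freshVar A.vars + i)).isVar = true
  split_ifs with h
  · exact h
  · rfl

/-- Every atom of the restriction of a clause is one of the clause or a `dom` atom for a variable. -/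
theorem mem_atoms_restrict {C : Clause} {A : Atom} (h : A ∈ C.restrict.atoms) :
    A ∈ C.atoms ∨ ∃ x, A = domAtom (.var x) := by
  simp only [Clause.restrict, Clause.atoms, List.mem_append, List.mem_map] at h ⊢
  rcases h with h | h | ⟨x, _, rfl⟩
  · exact .inl (.inl h)
  · exact .inl (.inr h)
  · exact .inr ⟨x, rfl⟩

theorem atoms_subset_restrict {C : Clause} {A : Atom} (h : A ∈ C.atoms) : A ∈ C.restrict.atoms := by
  simp only [Clause.restrict, Clause.atoms, List.mem_append] at h ⊢
  tauto

/-- The clause set `N` has no function symbols but those of `M` and constants, and no predicate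
symbols but those of `M` and `dom`. -/
def SymsIn (M N : Set Clause) : Prop :=
  ∀ C ∈ N, ∀ A ∈ C.atoms, (∀ f ∈ A.funs, f ∈ funSyms M ∨ f.arity = 0) ∧
    (A.pred ∈ predSyms M ∨ A.pred = .dom)

theorem SymsIn.union {M N N' : Set Clause} (h : SymsIn M N) (h' : SymsIn M N') :
    SymsIn M (N ∪ N') := fun C hC => hC.elim (h C) (h' C)

theorem SymsIn.restrict {M N : Set Clause} (h : SymsIn M N) : SymsIn M (Clause.restrict '' N) := by
  rintro _ ⟨C, hC, rfl⟩ A hA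
  obtain hA | ⟨x, rfl⟩ := mem_atoms_restrict hA
  · exact h C hC A hA
  · exact ⟨by simp [domVar_funs], .inr rfl⟩

theorem symsIn_self (M : Set Clause) : SymsIn M M := fun C hC A hA =>
  ⟨fun _ hf => .inl ⟨C, hC, A, hA, hf⟩, .inl (.inr ⟨C, hC, A, hA, rfl⟩)⟩

theorem symsIn_domConst (M : Set Clause) (c : ℕ) : SymsIn M {domConst c} := by
  rintro _ rfl A hA
  simp only [domConst, Clause.atoms, List.append_nil, List.mem_singleton] at hA
  subst hA
  exact ⟨by simp [domConst_funs], .inr rfl⟩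

theorem symsIn_bodyDom (M : Set Clause) : SymsIn M (bodyDom M) := by
  rintro _ ⟨C, hC, A, hA, i, _, rfl⟩ B hB
  have hA' : A ∈ C.atoms := List.mem_append_right _ hA
  simp only [Clause.atoms, List.cons_append, List.nil_append, List.mem_cons, List.not_mem_nil,
    or_false] at hB
  rcases hB with rfl | rfl
  · refine ⟨fun f hf => .inl ⟨C, hC, A, hA', ?_⟩, .inr rfl⟩
    rw [domAtom_funs] at hf
    exact List.mem_flatten.2 ⟨_, List.mem_ofFn.2 ⟨i, rfl⟩, hf⟩
  · exact ⟨by simp [abstraction_funs], .inl (.inr ⟨C, hC, A, hA', rfl⟩)⟩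

theorem symsIn_predDom (M : Set Clause) : SymsIn M (predDom M) := by
  rintro _ ⟨p, hp, i, rfl⟩ B hB
  simp only [Clause.atoms, List.cons_append, List.nil_append, List.mem_cons, List.not_mem_nil,
    or_false] at hB
  rcases hB with rfl | rfl
  · exact ⟨by simp [domVar_funs], .inr rfl⟩
  · exact ⟨by simp [funs_of_forall_isVar (A := genAtom p) fun _ => rfl], .inl hp⟩

theorem symsIn_funDom (M : Set Clause) : SymsIn M (funDom M) := by
  rintro _ ⟨f, hf, i, rfl⟩ B hB
  simp only [Clause.atoms, List.cons_append, List.nil_append, List.mem_cons, List.not_mem_nil,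
    or_false] at hB
  rcases hB with rfl | rfl
  · exact ⟨by simp [domVar_funs], .inr rfl⟩
  · refine ⟨fun g hg => .inl ?_, .inr rfl⟩
    rw [domAtom_funs, genTerm_funs, List.mem_singleton] at hg
    exact hg ▸ hf

theorem symsIn_domClosure (M : Set Clause) : SymsIn M {C | ∃ f ∈ funSyms M,
    C = ⟨[domAtom (genTerm f 0)], List.ofFn fun i : Fin f.arity => domAtom (.var i)⟩} := by
  rintro _ ⟨f, hf, rfl⟩ B hB
  simp only [Clause.atoms, List.cons_append, List.nil_append, List.mem_cons, List.mem_ofFn] at hB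
  rcases hB with rfl | ⟨i, rfl⟩
  · refine ⟨fun g hg => .inl ?_, .inr rfl⟩
    rw [domAtom_funs, genTerm_funs, List.mem_singleton] at hg
    exact hg ▸ hf
  · exact ⟨by simp [domVar_funs], .inr rfl⟩

theorem symsIn_restriction (r : Restriction) (c : ℕ) (M : Set Clause) : SymsIn M (r.apply c M) := by
  cases r
  · exact ((((symsIn_self M).union (symsIn_domConst M c)).union (symsIn_bodyDom M)).restrict.union
      (symsIn_predDom M)).union (symsIn_funDom M)
  · exact ((symsIn_self M).union (symsIn_domConst M c)).restrict.union (symsIn_domClosure M)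

theorem restrict_mem_restriction (r : Restriction) (c : ℕ) {M : Set Clause} {C : Clause}
    (hC : C ∈ M) : C.restrict ∈ r.apply c M := by
  cases r
  · exact .inl (.inl ⟨C, .inl (.inl hC), rfl⟩)
  · exact .inl ⟨C, .inl hC, rfl⟩

/-- Constants are excepted because the added c may be new; they do not matter for the subterm
axioms, which need an argument position. -/
theorem mem_funSyms_restriction (r : Restriction) (c : ℕ) (M : Set Clause) {f : FunSym}
    (hf : f.arity ≠ 0) : f ∈ funSyms (r.apply c M) ↔ f ∈ funSyms M := by
  constructor
  · rintro ⟨C, hC, A, hA, h⟩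
    exact ((symsIn_restriction r c M C hC A hA).1 f h).resolve_right hf
  · rintro ⟨C, hC, A, hA, h⟩
    exact ⟨_, restrict_mem_restriction r c hC, A, atoms_subset_restrict hA, h⟩

/-- Restriction introduces no predicate symbol but `dom`, which is not among the symbols counted
here. -/
theorem unarySyms_restriction (r : Restriction) (c : ℕ) (M : Set Clause) :
    unarySyms (r.apply c M) = unarySyms M := by
  ext p
  refine and_congr_left fun hp => ⟨?_, ?_⟩
  · rintro (rfl | ⟨C, hC, A, hA, rfl⟩)
    · exact .inl rfl
    · exact (symsIn_restriction r c M C hC A hA).2.resolve_right hp.2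
  · rintro (rfl | ⟨C, hC, A, hA, rfl⟩)
    · exact .inl rfl
    · exact .inr ⟨_, restrict_mem_restriction r c hC, A, atoms_subset_restrict hA, rfl⟩

theorem subAxioms_restriction (r : Restriction) (c : ℕ) (M : Set Clause) :
    subAxioms (r.apply c M) = subAxioms M := by
  ext D
  simp only [mem_subAxioms]
  refine or_congr_right (exists_congr fun f => and_congr_left ?_)
  rintro ⟨i, _⟩
  exact mem_funSyms_restriction r c M i.pos.ne'

theorem setOf_restrictionList (r : Restriction) (c : ℕ) (L : List Clause) :
    {C | C ∈ r.list c L} = r.apply c {C | C ∈ L} := by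
  cases r
  · exact setOf_rrList c L
  · exact setOf_crrList c L

theorem union_blockList (τ : Blocking) (r : Restriction) (c : ℕ) (L : List Clause) :
    r.apply c {C | C ∈ L} ∪ {C | C ∈ τ.list L} = τ.apply (r.apply c {C | C ∈ L}) := by
  have h : ∀ D, D ∈ subList L ↔ D ∈ subAxioms {C | C ∈ L} := fun D => by
    rw [← setOf_subList, Set.mem_ofPred_eq]
  ext D
  cases τ <;>
    simp only [Blocking.list, Blocking.apply, blsd, blsp, blud, blup, subAxioms_restriction,
      unarySyms_restriction, Set.mem_union, Set.mem_ofPred_eq, List.mem_cons, List.mem_append, h,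
      Set.mem_insert_iff, Set.mem_singleton_iff, mem_splitList, List.not_mem_nil, or_false,
      List.cons_append, List.nil_append] <;> grind

theorem setOf_trList (shift : Bool) (r : Restriction) (b : Option Blocking) (c : ℕ)
    (L : List Clause) : {C | C ∈ trList shift r b c L} = tr shift r b c {C | C ∈ L} := by
  have h : ∀ L : List Clause, {C | C ∈ r.list c L ++ blockList b L} =
      match b with
      | none => r.apply c {C | C ∈ L}
      | some τ => τ.apply (r.apply c {C | C ∈ L}) := fun L => by
    have : {C | C ∈ r.list c L ++ blockList b L} =
        r.apply c {C | C ∈ L} ∪ {C | C ∈ blockList b L} := by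
      rw [← setOf_restrictionList]
      ext D
      simp
    rw [this]
    cases b with
    | none => simp [blockList]
    | some τ => exact union_blockList τ r c L
  cases shift
  · exact h L
  · refine (h (shList L)).trans ?_
    rw [setOf_shList]
    rfl

theorem quadraticTime_tr (shift : Bool) (r : Restriction) (b : Option Blocking) :
    QuadraticTime (tr shift r b) :=
  quadraticTime_of_inTime (InTime.trList shift r b) (setOf_trList shift r b)

/-! ## Range restriction -/

theorem Atom.mem_vars {A : Atom} {x : ℕ} : x ∈ A.vars ↔ ∃ i, x ∈ (A.args i).vars := by
  simp [Atom.vars, List.mem_ofFn]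

theorem Term.mem_vars_app {f : FunSym} {args : Fin f.arity → Term} {x : ℕ} :
    x ∈ (Term.app f args).vars ↔ ∃ i, x ∈ (args i).vars := by
  simp [Term.vars, List.mem_ofFn]

theorem mem_atomsVars {l : List Atom} {x : ℕ} : x ∈ atomsVars l ↔ ∃ A ∈ l, x ∈ A.vars := by
  simp [atomsVars]

theorem domAtom_vars (t : Term) : (domAtom t).vars = t.vars := by
  simp [domAtom, Atom.vars, PredSym.arity]

theorem eqAtom_vars (s t : Term) : (eqAtom s t).vars = s.vars ++ t.vars := by
  simp [eqAtom, Atom.vars, PredSym.arity]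

theorem subAtom_vars (s t : Term) : (subAtom s t).vars = s.vars ++ t.vars := by
  simp [subAtom, Atom.vars, PredSym.arity]

theorem neg_vars (A : Atom) : A.neg.vars = A.vars := rfl

theorem mem_genTerm_vars {f : FunSym} {k x : ℕ} :
    x ∈ (genTerm f k).vars ↔ ∃ i : Fin f.arity, x = k + i := by
  simp [genTerm, Term.vars]

theorem mem_genAtom_vars {p : PredSym} {x : ℕ} :
    x ∈ (genAtom p).vars ↔ ∃ i : Fin p.arity, x = i := by
  rw [Atom.mem_vars]
  simp only [genAtom, Term.vars, List.mem_singleton]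

theorem mem_unaryAtom_vars {p : PredSym} (hp : p.arity = 1) {t : Term} {x : ℕ} :
    x ∈ (unaryAtom p t).vars ↔ x ∈ t.vars := by
  rw [Atom.mem_vars]
  exact ⟨fun ⟨_, h⟩ => h, fun h => ⟨⟨0, hp ▸ one_pos⟩, h⟩⟩

theorem Clause.rangeRestricted_of_head {C : Clause}
    (h : ∀ x ∈ atomsVars C.head, x ∈ atomsVars C.body) : C.RangeRestricted := fun x hx => by
  rw [Clause.vars, Clause.atoms, atomsVars, List.flatMap_append, List.mem_append] at hx
  exact hx.elim (h x) fun hx => hx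

theorem Clause.mem_headOnlyVars {C : Clause} {x : ℕ} :
    x ∈ C.headOnlyVars ↔ x ∈ atomsVars C.head ∧ x ∉ atomsVars C.body := by
  simp [Clause.headOnlyVars]

theorem Clause.rangeRestricted_restrict (C : Clause) : C.restrict.RangeRestricted := by
  refine Clause.rangeRestricted_of_head fun x hx => ?_
  rw [Clause.restrict, atomsVars, List.flatMap_append, List.mem_append]
  by_cases h : x ∈ atomsVars C.body
  · exact .inl h
  · refine .inr (mem_atomsVars.2 ⟨_, List.mem_map_of_mem (Clause.mem_headOnlyVars.2 ⟨hx, h⟩), ?_⟩)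
    simp [domAtom_vars, Term.vars]

theorem rangeRestricted_restriction (r : Restriction) (c : ℕ) (M : Set Clause) :
    RangeRestricted (r.apply c M) := by
  cases r
  · rintro _ ((⟨C, _, rfl⟩ | ⟨p, _, i, rfl⟩) | ⟨f, _, i, rfl⟩)
    · exact C.rangeRestricted_restrict
    · refine Clause.rangeRestricted_of_head fun x hx => ?_
      simp only [atomsVars, List.flatMap_singleton, domAtom_vars, Term.vars, List.mem_singleton,
        mem_genAtom_vars] at hx ⊢
      exact ⟨i, hx⟩
    · refine Clause.rangeRestricted_of_head fun x hx => ?_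
      simp only [atomsVars, List.flatMap_singleton, domAtom_vars, Term.vars, List.mem_singleton,
        mem_genTerm_vars] at hx ⊢
      exact ⟨i, by omega⟩
  · rintro _ (⟨C, _, rfl⟩ | ⟨f, _, rfl⟩)
    · exact C.rangeRestricted_restrict
    · refine Clause.rangeRestricted_of_head fun x hx => ?_
      simp only [atomsVars, List.flatMap_singleton, domAtom_vars, mem_genTerm_vars] at hx
      obtain ⟨i, rfl⟩ := hx
      exact mem_atomsVars.2 ⟨_, List.mem_ofFn.2 ⟨i, rfl⟩, by simp [domAtom_vars, Term.vars]⟩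

theorem rangeRestricted_consistency (p : PredSym) : (consistency p).RangeRestricted :=
  Clause.rangeRestricted_of_head fun x hx => by simp [consistency, atomsVars] at hx

theorem rangeRestricted_eqSplit {B : List Atom} (h₀ : 0 ∈ atomsVars B) (h₁ : 1 ∈ atomsVars B) :
    (eqSplit B).RangeRestricted := by
  refine Clause.rangeRestricted_of_head fun x hx => ?_
  simp only [eqSplit, atomsVars, List.flatMap_cons, List.flatMap_nil, neg_vars, eqAtom_vars,
    Term.vars, List.append_nil, List.mem_append, List.mem_singleton] at hx
  obtain rfl | rfl : x = 0 ∨ x = 1 := by tauto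
  exacts [h₀, h₁]

theorem rangeRestricted_subAxioms (M : Set Clause) : RangeRestricted (subAxioms M) := by
  rintro _ (rfl | ⟨f, _, i, rfl⟩) <;> refine Clause.rangeRestricted_of_head fun x hx => ?_
  · simpa [atomsVars, subAtom_vars, domAtom_vars, Term.vars] using hx
  · simp only [atomsVars, List.flatMap_cons, List.flatMap_nil, subAtom_vars, domAtom_vars,
      List.append_nil, List.mem_append] at hx ⊢
    tauto

theorem RangeRestricted.union {M N : Set Clause} (hM : RangeRestricted M)
    (hN : RangeRestricted N) : RangeRestricted (M ∪ N) := fun C hC => hC.elim (hM C) (hN C)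

theorem RangeRestricted.blocking {M : Set Clause} (hM : RangeRestricted M) (τ : Blocking) :
    RangeRestricted (τ.apply M) := by
  have hc : RangeRestricted {consistency .eq} := fun _ h => h ▸ rangeRestricted_consistency .eq
  have unary : ∀ p ∈ unarySyms M, ∀ x : ℕ, x ∈ (unaryAtom p (.var x)).vars := fun p hp x =>
    (mem_unaryAtom_vars hp.2.1).2 (List.mem_singleton_self x)
  cases τ
  · refine (hM.union (rangeRestricted_subAxioms M)).union ?_
    rintro _ (rfl | rfl)
    · exact rangeRestricted_eqSplit (by simp [atomsVars, subAtom_vars, Term.vars])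
        (by simp [atomsVars, subAtom_vars, Term.vars])
    · exact rangeRestricted_consistency .eq
  · refine ((hM.union (rangeRestricted_subAxioms M)).union ?_).union hc
    rintro _ ⟨p, hp, rfl⟩
    exact rangeRestricted_eqSplit (by simp [atomsVars, subAtom_vars, Term.vars])
      (by simp [atomsVars, subAtom_vars, Term.vars])
  · refine hM.union ?_
    rintro _ (rfl | rfl)
    · exact rangeRestricted_eqSplit (by simp [atomsVars, domAtom_vars, Term.vars])
        (by simp [atomsVars, domAtom_vars, Term.vars])
    · exact rangeRestricted_consistency .eq
  · refine (hM.union ?_).union hc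
    rintro _ ⟨p, hp, rfl⟩
    exact rangeRestricted_eqSplit (mem_atomsVars.2 ⟨_, by simp, unary p hp 0⟩)
      (mem_atomsVars.2 ⟨_, by simp, unary p hp 1⟩)

theorem rangeRestricted_tr (shift : Bool) (r : Restriction) (b : Option Blocking) (c : ℕ)
    (M : Set Clause) : RangeRestricted (tr shift r b c M) := by
  cases b with
  | none => exact rangeRestricted_restriction r c _
  | some τ => exact (rangeRestricted_restriction r c _).blocking τ

/-! ## E-satisfiability -/

theorem ESatisfiable.mono {M N : Set Clause} (h : ESatisfiable N) (hMN : M ⊆ N) :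
    ESatisfiable M :=
  let ⟨D, hD, I, hI, hM⟩ := h
  ⟨D, hD, I, hI, fun C hC => hM C (hMN hC)⟩

theorem lt_freshVar {l : List ℕ} {x : ℕ} (h : x ∈ l) : x < freshVar l := by
  induction l with
  | nil => simp at h
  | cons y l ih =>
    rw [freshVar, List.foldr_cons, ← freshVar]
    rcases List.mem_cons.1 h with rfl | h
    · exact lt_max_of_lt_left (Nat.lt_succ_self _)
    · exact lt_max_of_lt_right (ih h)

/-! ### Evaluation, and relativization of an interpretation to `dom`. -/

namespace Interp

variable {D : Type} {I : Interp D} {μ ν : ℕ → D}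

theorem rel_congr {p : PredSym} {a b : Fin p.arity → D} (h : ∀ i, a i = b i) :
    I.rel p a ↔ I.rel p b := by
  rw [funext h]

theorem eval_congr {t : Term} (h : ∀ x ∈ t.vars, μ x = ν x) : I.eval μ t = I.eval ν t := by
  induction t with
  | var x => exact h x (List.mem_singleton_self x)
  | app f args ih =>
    rw [eval, eval]
    congr 1
    funext i
    exact ih i fun x hx => h x (Term.mem_vars_app.2 ⟨i, hx⟩)

theorem satAtom_congr {A : Atom} (h : ∀ x ∈ A.vars, μ x = ν x) :
    I.SatAtom μ A ↔ I.SatAtom ν A :=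
  rel_congr fun i => eval_congr fun x hx => h x (Atom.mem_vars.2 ⟨i, hx⟩)

theorem satAtom_eqAtom (hI : I.IsE) (s t : Term) :
    I.SatAtom μ (eqAtom s t) ↔ I.eval μ s = I.eval μ t := by
  rw [← hI]
  exact rel_congr (p := .eq) fun (i : Fin 2) => match i with
    | 0 => rfl
    | 1 => rfl

/-- The elements in the interpretation of `dom`. -/
def InDom (I : Interp D) (d : D) : Prop := I.rel .dom fun _ => d

theorem satAtom_domAtom (t : Term) : I.SatAtom μ (domAtom t) ↔ I.InDom (I.eval μ t) := by
  exact rel_congr (p := .dom) fun (i : Fin 1) => match i with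
    | 0 => rfl

theorem SatClause.of_restrict {C : Clause} (h : I.SatClause C.restrict) (hμ : ∀ x, I.InDom (μ x))
    (hb : ∀ B ∈ C.body, I.SatAtom μ B) : ∃ H ∈ C.head, I.SatAtom μ H := by
  refine h μ fun B hB => ?_
  rcases List.mem_append.1 hB with hB | hB
  · exact hb B hB
  · obtain ⟨x, _, rfl⟩ := List.mem_map.1 hB
    exact (satAtom_domAtom _).2 (hμ x)

open Classical in
/-- The interpretation with domain `dom`; function values outside of it are redirected to `d`. -/
noncomputable def relativize (I : Interp D) (d : {d // I.InDom d}) : Interp {d // I.InDom d} where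
  fn f a := if h : I.InDom (I.fn f fun i => (a i).1) then ⟨_, h⟩ else d
  rel p a := I.rel p fun i => (a i).1

theorem relativize_isE (hI : I.IsE) (d : {d // I.InDom d}) : (I.relativize d).IsE := fun a b => by
  rw [Subtype.ext_iff, ← hI]
  exact rel_congr (I := I) (p := .eq) fun (i : Fin 2) => match i with
    | 0 => rfl
    | 1 => rfl

theorem relativize_eval_app {d : {d // I.InDom d}} {μ : ℕ → {d // I.InDom d}} {f : FunSym}
    {args : Fin f.arity → Term}
    (h : ∀ i, ((I.relativize d).eval μ (args i)).1 = I.eval (fun x => (μ x).1) (args i))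
    (hd : I.InDom (I.eval (fun x => (μ x).1) (.app f args))) :
    ((I.relativize d).eval μ (.app f args)).1 = I.eval (fun x => (μ x).1) (.app f args) := by
  rw [eval, ← funext h] at hd
  rw [eval, eval, ← funext h]
  exact congrArg Subtype.val (dif_pos hd)

theorem relativize_satAtom {d : {d // I.InDom d}} {μ : ℕ → {d // I.InDom d}} {A : Atom}
    (h : ∀ i, ((I.relativize d).eval μ (A.args i)).1 = I.eval (fun x => (μ x).1) (A.args i)) :
    (I.relativize d).SatAtom μ A ↔ I.SatAtom (fun x => (μ x).1) A :=
  rel_congr (I := I) h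

end Interp

/-- Common core of both restrictions. An atom has the same truth value in both interpretations as
soon as all its arguments have old values in `dom`. For body atoms this may be derived from truth in
the new interpretation, for head atoms from truth in the old one. So the body is carried to the old
model, the restricted clause is applied there, and the head atom obtained is carried back. -/
theorem eSatisfiable_of_relativize {D : Type} {I : Interp D} (hI : I.IsE) (d : {d // I.InDom d})
    {M : Set Clause} (hM : ∀ C ∈ M, I.SatClause C.restrict)
    (heval : ∀ C ∈ M, ∀ A ∈ C.atoms, ∀ i (μ : ℕ → {d // I.InDom d}),
      I.InDom (I.eval (fun x => (μ x).1) (A.args i)) →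
      ((I.relativize d).eval μ (A.args i)).1 = I.eval (fun x => (μ x).1) (A.args i))
    (hbody : ∀ C ∈ M, ∀ A ∈ C.body, ∀ μ : ℕ → {d // I.InDom d}, (I.relativize d).SatAtom μ A →
      ∀ i, I.InDom (I.eval (fun x => (μ x).1) (A.args i)))
    (hhead : ∀ C ∈ M, ∀ A ∈ C.head, ∀ μ : ℕ → {d // I.InDom d}, I.SatAtom (fun x => (μ x).1) A →
      ∀ i, I.InDom (I.eval (fun x => (μ x).1) (A.args i))) :
    ESatisfiable M := by
  refine ⟨_, ⟨d⟩, I.relativize d, Interp.relativize_isE hI d, fun C hC μ hb => ?_⟩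
  obtain ⟨H, hH, h⟩ := (hM C hC).of_restrict (μ := fun x => (μ x).1) (fun x => (μ x).2)
    fun B hB => (Interp.relativize_satAtom fun i => heval C hC B (List.mem_append_right _ hB) i μ
      (hbody C hC B hB μ (hb B hB) i)).1 (hb B hB)
  exact ⟨H, hH, (Interp.relativize_satAtom fun i => heval C hC H (List.mem_append_left _ hH) i μ
    (hhead C hC H hH μ h i)).2 h⟩

theorem Term.mem_funs_app {f g : FunSym} {args : Fin f.arity → Term} :
    g ∈ (Term.app f args).funs ↔ g = f ∨ ∃ i, g ∈ (args i).funs := by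
  simp [Term.funs, List.mem_ofFn]

theorem mem_funSyms_of_args {M : Set Clause} {C : Clause} {A : Atom} {f : FunSym} (hC : C ∈ M)
    (hA : A ∈ C.atoms) {i : Fin A.pred.arity} (hf : f ∈ (A.args i).funs) : f ∈ funSyms M :=
  ⟨C, hC, A, hA, List.mem_flatten.2 ⟨_, List.mem_ofFn.2 ⟨i, rfl⟩, hf⟩⟩

theorem inDom_const {D : Type} {I : Interp D} {c : ℕ} (h : I.SatClause (domConst c).restrict)
    [Nonempty D] : ∃ d, I.InDom d := by
  have μ : ℕ → D := fun _ => Classical.arbitrary D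
  obtain ⟨H, hH, h⟩ := h μ fun B hB => by
    have : (domConst c).headOnlyVars = [] := by
      rw [List.eq_nil_iff_forall_not_mem]
      intro x hx
      have := (Clause.mem_headOnlyVars.1 hx).1
      simp [domConst, atomsVars, domAtom_vars, constTerm, Term.vars] at this
    rw [Clause.restrict, this] at hB
    simp [domConst] at hB
  rw [List.mem_singleton.1 hH, Interp.satAtom_domAtom] at h
  exact ⟨_, h⟩

/-- The closure clauses make `dom` a substructure for the functions of M, so all terms of M keep
their values. -/
theorem eSatisfiable_of_crr {c : ℕ} {M : Set Clause} (h : ESatisfiable (crr c M)) :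
    ESatisfiable M := by
  obtain ⟨D, hD, I, hI, hM⟩ := h
  obtain ⟨d, hd⟩ := inDom_const (hM _ (.inl ⟨_, .inr rfl, rfl⟩))
  have hclosed : ∀ f ∈ funSyms M, ∀ a : Fin f.arity → D, (∀ i, I.InDom (a i)) →
      I.InDom (I.fn f a) := fun f hf a ha => by
    -- The valuation maps the variable i to the i-th argument; `d` only fills the irrelevant
    -- variables.
    have e : ∀ i : Fin f.arity, (if h : (i : ℕ) < f.arity then a ⟨i, h⟩ else d) = a i :=
      fun i => dif_pos i.2
    obtain ⟨H, hH, h⟩ := hM _ (.inr ⟨f, hf, rfl⟩)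
      (fun x => if h : x < f.arity then a ⟨x, h⟩ else d) fun B hB => by
        obtain ⟨i, rfl⟩ := List.mem_ofFn.1 hB
        rw [Interp.satAtom_domAtom, Interp.eval, e]
        exact ha i
    rw [List.mem_singleton.1 hH, Interp.satAtom_domAtom, genTerm, Interp.eval] at h
    simpa only [Interp.eval, Nat.zero_add, e] using h
  have key : ∀ (t : Term) (μ : ℕ → {d // I.InDom d}), (∀ f ∈ t.funs, f ∈ funSyms M) →
      I.InDom (I.eval (fun x => (μ x).1) t) ∧
      ((I.relativize ⟨d, hd⟩).eval μ t).1 = I.eval (fun x => (μ x).1) t := fun t μ ht => by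
    induction t with
    | var x => exact ⟨(μ x).2, rfl⟩
    | app f args ih =>
      have ih := fun i => ih i fun g hg => ht g (Term.mem_funs_app.2 (.inr ⟨i, hg⟩))
      have hd := hclosed f (ht f (Term.mem_funs_app.2 (.inl rfl))) _ fun i => (ih i).1
      exact ⟨hd, Interp.relativize_eval_app (fun i => (ih i).2) hd⟩
  have key' : ∀ C ∈ M, ∀ A ∈ C.atoms, ∀ i (μ : ℕ → {d // I.InDom d}), _ := fun C hC A hA i μ =>
    key (A.args i) μ fun f hf => mem_funSyms_of_args hC hA hf
  exact eSatisfiable_of_relativize hI ⟨d, hd⟩ (fun C hC => hM _ (.inl ⟨C, .inl hC, rfl⟩))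
    (fun C hC A hA i μ _ => (key' C hC A hA i μ).2)
    (fun C hC A hA μ _ i => (key' C hC A (List.mem_append_right _ hA) i μ).1)
    (fun C hC A hA μ _ i => (key' C hC A (List.mem_append_left _ hA) i μ).1)

/-- A valuation takes given values at the variables from `k` on, and is `μ` elsewhere. -/
theorem exists_valuation {D : Type} (μ : ℕ → D) (k : ℕ) {n : ℕ} (a : Fin n → D) :
    ∃ ν : ℕ → D, (∀ x < k, ν x = μ x) ∧ ∀ i : Fin n, ν (k + i) = a i := by
  refine ⟨fun x => if h : k ≤ x ∧ x - k < n then a ⟨x - k, h.2⟩ else μ x,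
    fun x hx => dif_neg (by omega), fun i => ?_⟩
  have h : k ≤ k + (i : ℕ) ∧ k + (i : ℕ) - k < n := by omega
  refine (dif_pos h).trans (congrArg a ?_)
  ext
  simp

/-- Here `dom` is closed downwards only, from f(a₁, …, aₙ) to its arguments (`hfun`), so terms are
evaluated alike only if their old value is in `dom` (`heval`). The remaining clauses of `rr` supply
this for the arguments of true atoms. -/
theorem eSatisfiable_of_rr {c : ℕ} {M : Set Clause} (h : ESatisfiable (rr c M)) :
    ESatisfiable M := by
  obtain ⟨D, hD, I, hI, hM⟩ := h
  obtain ⟨d, hd⟩ := inDom_const (hM _ (.inl (.inl ⟨_, .inl (.inr rfl), rfl⟩)))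
  have hfun : ∀ f ∈ funSyms M, ∀ a : Fin f.arity → D, I.InDom (I.fn f a) → ∀ i, I.InDom (a i) :=
    fun f hf a ha i => by
    obtain ⟨ν, -, hν⟩ := exists_valuation (fun _ => d) 0 a
    obtain ⟨H, hH, h⟩ := hM _ (.inr ⟨f, hf, i, rfl⟩) ν fun B hB => by
      rw [List.mem_singleton.1 hB, Interp.satAtom_domAtom, genTerm, Interp.eval]
      simpa only [Interp.eval, hν] using ha
    rw [List.mem_singleton.1 hH, Interp.satAtom_domAtom, Interp.eval] at h
    rwa [← hν i, Nat.zero_add]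
  have heval : ∀ (t : Term) (μ : ℕ → {d // I.InDom d}), (∀ f ∈ t.funs, f ∈ funSyms M) →
      I.InDom (I.eval (fun x => (μ x).1) t) →
      ((I.relativize ⟨d, hd⟩).eval μ t).1 = I.eval (fun x => (μ x).1) t := fun t μ ht hdom => by
    induction t with
    | var x => rfl
    | app f args ih =>
      have hargs := hfun f (ht f (Term.mem_funs_app.2 (.inl rfl))) _ hdom
      exact Interp.relativize_eval_app (fun i =>
        ih i (fun g hg => ht g (Term.mem_funs_app.2 (.inr ⟨i, hg⟩))) (hargs i)) hdom
  refine eSatisfiable_of_relativize hI ⟨d, hd⟩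
    (fun C hC => hM _ (.inl (.inl ⟨C, .inl (.inl hC), rfl⟩)))
    (fun C hC A hA i μ => heval _ μ fun f hf => mem_funSyms_of_args hC hA hf) ?_ ?_
  · intro C hC A hA μ hsat i
    cases hi : (A.args i).isVar
    -- The fresh variables of the abstraction receive the relativized, possibly redirected, values
    -- of the arguments. Under ν the abstraction then holds in the old model exactly because the
    -- atom holds in the new one.
    · obtain ⟨ν, hν, hν'⟩ := exists_valuation μ (freshVar A.vars)
        fun i => (I.relativize ⟨d, hd⟩).eval μ (A.args i)
      have hμν : ∀ x ∈ A.vars, (ν x).1 = (μ x).1 := fun x hx => by rw [hν x (lt_freshVar hx)]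
      -- The clause dom(tᵢ) ← P(s₁, …, sₙ) was itself restricted; its additional `dom` atoms hold
      -- because ν takes values in `dom` only. As ν agrees with μ on the variables of tᵢ, the old
      -- value of tᵢ under μ is in `dom`.
      obtain ⟨H, hH, h⟩ := (hM _ (.inl (.inl ⟨_, .inr ⟨C, hC, A, hA, i, hi, rfl⟩, rfl⟩))
        ).of_restrict (μ := fun x => (ν x).1) (fun x => (ν x).2) fun B hB => by
          rw [List.mem_singleton.1 hB]
          refine (Interp.rel_congr (I := I) (p := A.pred) fun j => ?_).1 hsat
          symm
          change I.eval _ (if (A.args j).isVar then A.args j else .var (freshVar A.vars + j)) = _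
          split_ifs with hj
          · cases h : A.args j with
            | var x =>
              have hx : x ∈ (A.args j).vars := by rw [h]; exact List.mem_singleton_self x
              change _ = ((I.relativize ⟨d, hd⟩).eval μ (A.args j)).1
              rw [h]
              exact hμν x (Atom.mem_vars.2 ⟨j, hx⟩)
            | app f args => simp [h, Term.isVar] at hj
          · rw [Interp.eval, hν']
      rw [List.mem_singleton.1 hH, Interp.satAtom_domAtom] at h
      rwa [Interp.eval_congr fun x hx => hμν x (Atom.mem_vars.2 ⟨i, hx⟩)] at h
    · cases h : A.args i with
      | var x => exact (μ x).2
      | app f args => simp [h, Term.isVar] at hi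
  · intro C hC A hA μ hsat i
    obtain ⟨ν, -, hν⟩ := exists_valuation (fun x => (μ x).1) 0
      fun i => I.eval (fun x => (μ x).1) (A.args i)
    obtain ⟨H, hH, h⟩ := hM _ (.inl (.inr ⟨A.pred,
      .inr ⟨C, hC, A, List.mem_append_left _ hA, rfl⟩, i, rfl⟩)) ν fun B hB => by
        rw [List.mem_singleton.1 hB]
        refine (Interp.rel_congr (I := I) (p := A.pred) fun j => ?_).1 hsat
        rw [← hν j, Nat.zero_add]
        rfl
    rw [List.mem_singleton.1 hH, Interp.satAtom_domAtom, Interp.eval] at h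
    rwa [← hν i, Nat.zero_add]

theorem eSatisfiable_of_restriction {r : Restriction} {c : ℕ} {M : Set Clause}
    (h : ESatisfiable (r.apply c M)) : ESatisfiable M := by
  cases r
  · exact eSatisfiable_of_rr h
  · exact eSatisfiable_of_crr h

/-! ### Shifting and blocking undone in a fixed interpretation. -/

namespace Interp

variable {D : Type} {I : Interp D}

/-- If the true head atom of the shifted clause is the negated copy of a body atom A, then A holds
too, and the consistency clause, with its variables set to the values of the arguments of A, is
violated. -/
theorem SatClause.of_shift {C : Clause} (h : I.SatClause C.shift)
    (hc : ∀ A ∈ C.body, A.isDeep = true → I.SatClause (consistency A.pred)) : I.SatClause C := by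
  intro μ hb
  obtain ⟨H, hH, hsat⟩ := h μ fun B hB => hb B (List.mem_filter.1 hB).1
  rcases List.mem_append.1 hH with hH | hH
  · exact ⟨H, hH, hsat⟩
  · obtain ⟨A, hA, rfl⟩ := List.mem_map.1 hH
    obtain ⟨hA, hdeep⟩ := List.mem_filter.1 hA
    obtain ⟨ν, -, hν⟩ := exists_valuation μ 0 fun i => I.eval μ (A.args i)
    have e : (fun i : Fin A.pred.arity => ν i) = fun i => I.eval μ (A.args i) := by
      funext i
      rw [← hν i, Nat.zero_add]
    obtain ⟨_, h, _⟩ := hc A hA hdeep ν fun B hB => by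
      simp only [consistency, List.mem_cons, List.not_mem_nil, or_false] at hB
      rcases hB with rfl | rfl
      · change I.rel A.pred fun i : Fin A.pred.arity => ν i
        rw [e]
        exact hb A hA
      · change I.rel (.neg A.pred) fun i : Fin A.pred.arity => ν i
        rw [e]
        exact hsat
    simp [consistency] at h

/-- Each fresh variable is given the value of the term it replaces; then the added equations hold
because ≈ is the identity. The bound m on the given variables is kept apart from the next fresh
variable k, which grows along the list. -/
theorem exists_sat_flat (hI : I.IsE) (l : List Atom) (k m : ℕ) (hmk : m ≤ k)
    (hl : ∀ A ∈ l, ∀ x ∈ A.vars, x < m) (μ : ℕ → D) (hsat : ∀ A ∈ l, I.SatAtom μ A) :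
    ∃ ν : ℕ → D, (∀ x < k, ν x = μ x) ∧ (∀ A ∈ flatAtoms k l, I.SatAtom ν A) ∧
      ∀ A ∈ flatAtomsEqs k l, I.SatAtom ν A := by
  induction l generalizing k μ with
  | nil => exact ⟨μ, fun _ _ => rfl, by simp [flatAtoms], by simp [flatAtomsEqs]⟩
  | cons A l ih =>
    obtain ⟨μ', hμ, hμ'⟩ := exists_valuation μ k fun i => I.eval μ (A.args i)
    obtain ⟨ν, hν, h₁, h₂⟩ := ih (k + A.pred.arity) (by omega)
      (fun B hB => hl B (List.mem_cons_of_mem _ hB)) μ' fun B hB =>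
        (satAtom_congr fun x hx => hμ x
          ((hl B (List.mem_cons_of_mem _ hB) x hx).trans_le hmk)).2
            (hsat B (List.mem_cons_of_mem _ hB))
    have hνμ : ∀ x < k, ν x = μ x := fun x hx => (hν x (by omega)).trans (hμ x hx)
    have hvar : ∀ i : Fin A.pred.arity, ν (k + i) = I.eval μ (A.args i) := fun i =>
      (hν _ (by omega)).trans (hμ' i)
    have hA := hsat A List.mem_cons_self
    have hvars : ∀ x ∈ A.vars, ν x = μ x := fun x hx =>
      hνμ x ((hl A List.mem_cons_self x hx).trans_le hmk)
    have harg : ∀ i, I.eval ν (A.args i) = I.eval μ (A.args i) := fun i =>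
      eval_congr fun x hx => hvars x (Atom.mem_vars.2 ⟨i, hx⟩)
    refine ⟨ν, hνμ, fun B hB => ?_, fun B hB => ?_⟩
    · rcases List.mem_cons.1 hB with rfl | hB
      · rw [Atom.flat]
        split_ifs
        · exact (satAtom_congr hvars).2 hA
        · refine (rel_congr (I := I) (p := A.pred) fun i => ?_).1 hA
          symm
          change I.eval ν (if (A.args i).isProper then .var (k + i) else A.args i) = _
          split_ifs
          · exact hvar i
          · exact harg i
      · exact h₁ B hB
    · rcases List.mem_append.1 hB with hB | hB
      · rw [Atom.flatEqs] at hB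
        split_ifs at hB
        · simp at hB
        · obtain ⟨L, hL, hB⟩ := List.mem_flatten.1 hB
          obtain ⟨i, rfl⟩ := List.mem_ofFn.1 hL
          split_ifs at hB
          · rw [List.mem_singleton.1 hB, satAtom_eqAtom hI, harg, eval, hvar]
          · simp at hB
      · exact h₂ B hB

theorem SatClause.of_flatten (hI : I.IsE) {C : Clause} (h : I.SatClause C.flatten) :
    I.SatClause C := by
  intro μ hb
  have hvars : ∀ A ∈ C.atoms, ∀ x ∈ A.vars, x < freshVar C.vars := fun A hA x hx =>
    lt_freshVar (mem_atomsVars.2 ⟨A, hA, hx⟩)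
  obtain ⟨ν, hν, h₁, h₂⟩ := exists_sat_flat hI C.body _ _ le_rfl
    (fun A hA => hvars A (List.mem_append_right _ hA)) μ hb
  obtain ⟨H, hH, hsat⟩ := h ν fun B hB => (List.mem_append.1 hB).elim (h₁ B) (h₂ B)
  exact ⟨H, hH, (satAtom_congr fun x hx =>
    hν x (hvars H (List.mem_append_left _ hH) x hx)).1 hsat⟩

end Interp

theorem eSatisfiable_of_sh {M : Set Clause} (h : ESatisfiable (sh M)) : ESatisfiable M := by
  obtain ⟨D, hD, I, hI, hM⟩ := h
  refine ⟨D, hD, I, hI, fun C hC => .of_flatten hI (.of_shift ?_ fun A hA hdeep => ?_)⟩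
  · exact hM _ (.inl ⟨_, ⟨C, .inl hC, rfl⟩, rfl⟩)
  · exact hM _ (.inr ⟨_, ⟨C, .inl hC, rfl⟩, A, hA, hdeep, rfl⟩)

theorem subset_blocking (τ : Blocking) (M : Set Clause) : M ⊆ τ.apply M := by
  intro C hC
  cases τ
  · exact .inl (.inl hC)
  · exact .inl (.inl (.inl hC))
  · exact .inl hC
  · exact .inl (.inl hC)

theorem eSatisfiable_of_tr {shift : Bool} {r : Restriction} {b : Option Blocking} {c : ℕ}
    {M : Set Clause} (h : ESatisfiable (tr shift r b c M)) : ESatisfiable M := by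
  have h : ESatisfiable (r.apply c (if shift then sh M else M)) := by
    cases b with
    | none => exact h
    | some τ => exact h.mono (subset_blocking τ _)
  have h := eSatisfiable_of_restriction h
  cases shift
  · exact h
  · exact eSatisfiable_of_sh h

end BUMG

theorem mainTheorem1 (shift : Bool) (r : BUMG.Restriction) (b : Option BUMG.Blocking) :
    (∀ (c : ℕ) (M : Set BUMG.Clause), M.Finite → BUMG.IsInput M →
      BUMG.RangeRestricted (BUMG.tr shift r b c M)) ∧
    BUMG.QuadraticTime (BUMG.tr shift r b) ∧
    (∀ (c : ℕ) (M : Set BUMG.Clause), M.Finite → BUMG.IsInput M →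
      BUMG.ESatisfiable (BUMG.tr shift r b c M ∪ {BUMG.domRefl}) → BUMG.ESatisfiable M) :=
  ⟨fun c M _ _ => BUMG.rangeRestricted_tr shift r b c M, BUMG.quadraticTime_tr shift r b,
    fun _ _ _ _ h => BUMG.eSatisfiable_of_tr (h.mono Set.subset_union_left)⟩
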